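/- Let $R$ be a commutative unital ring, $n\ge 0$, let $A=\Lambda[x_1,\dots,x_n]=\Lambda(R^n)$ be the $n$-th exterior algebra over $R$, and let $A^e=A\otimes_R A^{\mathrm{op}}$ be its enveloping algebra, acting on $A$ by $(\alpha\otimes\beta)a=\alpha a\beta$ and on $A^{\otimes k+2}$ by $(\alpha\otimes\beta)(a_0\otimes\dots\otimes a_{k+1})=\alpha a_0\otimes a_1\otimes\dots\otimes a_k\otimes a_{k+1}\beta$. For a $k$-element multisubset $\tau$ of $[n]=\{1,\dots,n\}$ let $\bar\tau$ be its set of distinct elements. Let $\mathring B_k$ be the free $A^e$-module on the symbols $x_{(\tau)}$, $\tau$ running over the $k$-element multisubsets of $[n]$, and for $k\ge1$ let $\mathring b_k:\mathring B_k\to\mathring B_{k-1}$ be the $A^e$-linear map with $$\mathring b_k(x_{(\tau)})=\sum_{i\in\bar\tau}\bigl(x_i\otimes 1+(-1)^k\,1\otimes x_i\bigr)\,x_{(\tau\setminus\{i\})}.$$ (a) With the augmentation $\mathring B_0\to A$, $x_{(\emptyset)}\mapsto 1$, the complex $(\mathring B_*,\mathring b_*)$ is a free resolution of the $A^e$-module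 $A$. (b) The resolution is minimal: every $\operatorname{im}\mathring b_{k+1}$ is a superfluous submodule of $\mathring B_k$ (a submodule $P$ with $P+\operatorname{im}\mathring b_{k+1}=\mathring B_k$ equals $\mathring B_k$), and, if $R\neq0$, no matrix entry of any $\mathring b_k$ in the bases $\{x_{(\tau)}\}$ is a unit of $A^e$. (c) The resolution is obtained from the bar resolution by algebraic Morse theory. Let $B_k=A^{\otimes k+2}$, with $b_k(a_0\otimes\dots\otimes a_{k+1})=\sum_{i=0}^{k}(-1)^i a_0\otimes\dots\otimes a_ia_{i+1}\otimes\dots\otimes a_{k+1}$, be the bar resolution of $A$, augmented by the multiplication $b_0:B_0=A\otimes A\to A$. For $\sigma\subseteq[n]$ let $x_\sigma$ be the product of the $x_i$, $i\in\sigma$, in increasing order. The $A^e$-basis elements $1\otimes x_{\sigma_1}\otimes\dots\otimes x_{\sigma_k}\otimes1$ with some $\sigma_j=\emptyset$ span a subcomplex; the quotient by it (the normalized bar resolution) has as basis those with all $\sigma_j\ne\emptyset$. Let $\Gamma$ be the digraph on the latter basis elements whose weighted edges are the nonzero entries of the differential, and let $\mathcal M$ consist of the edges from $1\otimes x_{i_1}\otimes\dots\otimes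 x_{i_{r-1}}\otimes x_i\otimes x_{\sigma_r\setminus\{i\}}\otimes x_{\sigma_{r+1}}\otimes\dots\otimes x_{\sigma_k}\otimes1$ to $1\otimes x_{i_1}\otimes\dots\otimes x_{i_{r-1}}\otimes x_{\sigma_r}\otimes x_{\sigma_{r+1}}\otimes\dots\otimes x_{\sigma_k}\otimes1$ with $r\ge1$, $i_1\le\dots\le i_{r-1}\le i=\max\sigma_r$ and $\sigma_r\setminus\{i\}\neq\emptyset$. Let $\Gamma^{\mathcal M}$ be $\Gamma$ with the edges of $\mathcal M$ reversed, a reversed edge of weight $w$ getting weight $-w^{-1}$. Then $\mathcal M$ is a Morse matching (its edges have invertible weights, every vertex lies on at most one of them, and $\Gamma^{\mathcal M}$ has no directed cycles and no infinite paths in two adjacent degrees); the vertices not on an edge of $\mathcal M$ are exactly the elements $1\otimes x_{i_1}\otimes\dots\otimes x_{i_k}\otimes1$ with $i_1\le\dots\le i_k$, which correspond bijectively to the symbols $x_{(\tau)}$, $\tau=\{i_1\le\dots\le i_k\}$; the entry of $\mathring b_k$ at $x_{(\tau)}$, $x_{(\tau')}$ is the (finite) sum of the weights of all directed paths in $\Gamma^{\mathcal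 M}$ from $x_{(\tau)}$ to $x_{(\tau')}$, the weight of a path being the product in $A^e$ of the weights of its edges in path order; and $\mathring B_*$ is homotopy equivalent to $B_*$ as complexes of $A^e$-modules, compatibly with the augmentations to $A$. -/

import Mathlib

open scoped TensorProduct

noncomputable section

/-! ### Enveloping algebras and bimodules -/

/-- The enveloping algebra `Aᵉ = A ⊗ Aᵒᵖ` of an `R`-algebra `A`. -/
abbrev Env (R A : Type*) [CommRing R] [Ring A] [Algebra R A] : Type _ := A ⊗[R] Aᵐᵒᵖ

/-- The `R`-module `A`, viewed as an `Aᵉ`-module. -/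
def RegBimod (R A : Type*) [CommRing R] [Ring A] [Algebra R A] : Type _ := A

section RegBimod

variable (R A : Type*) [CommRing R] [Ring A] [Algebra R A]

instance : AddCommGroup (RegBimod R A) := inferInstanceAs (AddCommGroup A)

instance : Module R (RegBimod R A) := inferInstanceAs (Module R A)

/-- `Aᵉ` acts on `A` by `(α ⊗ β) • a = α a β`. -/
instance : Module (Env R A) (RegBimod R A) :=
  letI : Module (Module.End R A) (RegBimod R A) := inferInstanceAs (Module (Module.End R A) A)
  Module.compHom (RegBimod R A) (AlgHom.mulLeftRight R A).toRingHom

variable {A} in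
/-- An element of `A`, viewed in the bimodule `A`. -/
def RegBimod.of (a : A) : RegBimod R A := a

theorem env_smul_of (α β a : A) :
    (α ⊗ₜ[R] MulOpposite.op β : Env R A) • RegBimod.of R a = RegBimod.of R (α * a * β) :=
  AlgHom.mulLeftRight_apply R A α (MulOpposite.op β) a

instance : IsScalarTower R (Env R A) (RegBimod R A) where
  smul_assoc r e a := by
    change AlgHom.mulLeftRight R A (r • e) a = r • AlgHom.mulLeftRight R A e a
    rw [map_smul]
    rfl

end RegBimod

/-! ### Complexes, resolutions, minimality, homotopy equivalence -/

section Complexes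

variable {S : Type*} [Ring S] {N : Type*} [AddCommGroup N] [Module S N]
  {X Y : ℕ → Type*} [∀ k, AddCommGroup (X k)] [∀ k, Module S (X k)]
  [∀ k, AddCommGroup (Y k)] [∀ k, Module S (Y k)]

/-- The augmented sequence `⋯ → X 1 → X 0 → N → 0` is exact and all `X k` are free,
i.e. `X` is a free resolution of `N`. -/
def IsFreeResolution (d : ∀ k, X (k + 1) →ₗ[S] X k) (ε : X 0 →ₗ[S] N) : Prop :=
  (∀ k, Module.Free S (X k)) ∧ Function.Surjective ε ∧ Function.Exact (d 0) ε ∧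
    ∀ k, Function.Exact (d (k + 1)) (d k)

/-- Minimality: for every `k` the image of `d k` is a superfluous (small) submodule of `X k`.
For a projective resolution this says that each `X k` is a projective cover of its image. -/
def IsMinimalComplex (d : ∀ k, X (k + 1) →ₗ[S] X k) : Prop :=
  ∀ (k : ℕ) (P : Submodule S (X k)), P ⊔ LinearMap.range (d k) = ⊤ → P = ⊤

/-- `f` is a chain map over the identity of `N`. -/
def IsChainMapOver (dX : ∀ k, X (k + 1) →ₗ[S] X k) (εX : X 0 →ₗ[S] N)
    (dY : ∀ k, Y (k + 1) →ₗ[S] Y k) (εY : Y 0 →ₗ[S] N) (f : ∀ k, X k →ₗ[S] Y k) : Prop :=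
  εY ∘ₗ f 0 = εX ∧ ∀ k, f k ∘ₗ dX k = dY k ∘ₗ f (k + 1)

/-- `s` is a chain homotopy from `id` to `φ`. -/
def IsHomotopyToId (dX : ∀ k, X (k + 1) →ₗ[S] X k) (φ : ∀ k, X k →ₗ[S] X k)
    (s : ∀ k, X k →ₗ[S] X (k + 1)) : Prop :=
  φ 0 - LinearMap.id = dX 0 ∘ₗ s 0 ∧
    ∀ k, φ (k + 1) - LinearMap.id = dX (k + 1) ∘ₗ s (k + 1) + s k ∘ₗ dX k

/-- The complexes `X` and `Y`, both augmented over `N`, are homotopy equivalent over `N`. -/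
def AreHomotopyEquivalentOver (dX : ∀ k, X (k + 1) →ₗ[S] X k) (εX : X 0 →ₗ[S] N)
    (dY : ∀ k, Y (k + 1) →ₗ[S] Y k) (εY : Y 0 →ₗ[S] N) : Prop :=
  ∃ (f : ∀ k, X k →ₗ[S] Y k) (g : ∀ k, Y k →ₗ[S] X k)
    (s : ∀ k, X k →ₗ[S] X (k + 1)) (t : ∀ k, Y k →ₗ[S] Y (k + 1)),
    IsChainMapOver dX εX dY εY f ∧ IsChainMapOver dY εY dX εX g ∧
    IsHomotopyToId dX (fun k => g k ∘ₗ f k) s ∧ IsHomotopyToId dY (fun k => f k ∘ₗ g k) t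

end Complexes

/-! ### Algebraic Morse theory -/

section Morse

universe u

/-- A complex of free left `S`-modules with chosen bases `V k` in degree `k` is recorded by the
entries of its differential: `d v = ∑ u, W k v u • u` for `v : V (k + 1)`.  A set of pairs
`M k v u` is to be reversed.  This is the type of vertices of the digraph `Γ^M`. -/
structure MorseVertex {S : Type*} {V : ℕ → Type u} (W : ∀ k, V (k + 1) → V k → S)
    (M : ∀ k, V (k + 1) → V k → Prop) where
  /-- the degree -/
  deg : ℕ
  /-- the basis element -/
  cell : V deg

variable {S : Type*} [Ring S] {V : ℕ → Type u} (W : ∀ k, V (k + 1) → V k → S)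
  (M : ∀ k, V (k + 1) → V k → Prop)

/-- The edges of the digraph `Γ^M`: the nonzero entries outside `M`, and the reversed
elements of `M`. -/
inductive MorseEdge : MorseVertex W M → MorseVertex W M → Type u
  | down (k : ℕ) (v : V (k + 1)) (w : V k) (hW : W k v w ≠ 0) (hM : ¬ M k v w) :
      MorseEdge ⟨k + 1, v⟩ ⟨k, w⟩
  | up (k : ℕ) (v : V (k + 1)) (w : V k) (hM : M k v w) : MorseEdge ⟨k, w⟩ ⟨k + 1, v⟩

instance morseQuiver : Quiver (MorseVertex W M) where
  Hom a b := MorseEdge W M a b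

/-- The weight of an edge of `Γ^M`: the entry of the differential on an edge that is not
reversed, minus its inverse on a reversed one. -/
def MorseEdge.weight : ∀ {a b : MorseVertex W M}, MorseEdge W M a b → S
  | _, _, .down k v w _ _ => W k v w
  | _, _, .up k v w _ => -Ring.inverse (W k v w)

/-- The sum of the weights of all directed paths from `a` to `b` in `Γ^M`, the weight of a path
being the product of the weights of its edges in their order along the path. -/
def pathSum (a b : MorseVertex W M) : S :=
  ∑ᶠ p : Quiver.Path a b, p.weight (fun {_ _} e => MorseEdge.weight W M e)

/-- `M` is a Morse matching: its edges have invertible weights, every vertex lies on at most one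
of them, and the digraph `Γ^M` has no directed cycles and no infinite paths in two adjacent
degrees. -/
structure IsMorseMatching : Prop where
  isUnit : ∀ k v w, M k v w → IsUnit (W k v w)
  target_unique : ∀ k v w w', M k v w → M k v w' → w = w'
  source_unique : ∀ k v v' w, M k v w → M k v' w → v = v'
  not_both : ∀ k v w t, M (k + 1) v w → ¬ M k w t
  acyclic : ∀ (a : MorseVertex W M) (p : Quiver.Path a a), p.length = 0
  no_infinite : ∀ k : ℕ, ¬ ∃ f : ℕ → MorseVertex W M,
    (∀ m, Nonempty (f m ⟶ f (m + 1))) ∧ ∀ m, (f m).deg = k ∨ (f m).deg = k + 1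

/-- The vertex lies on an edge of the matching. -/
inductive IsMatched : ∀ {k : ℕ}, V k → Prop
  | source {k : ℕ} {v : V (k + 1)} {w : V k} (h : M k v w) : IsMatched v
  | target {k : ℕ} {v : V (k + 1)} {w : V k} (h : M k v w) : IsMatched w

end Morse

/-! ### The bar resolution -/

section Bar

variable (R A : Type*) [CommRing R] [Ring A] [Algebra R A]

/-- The `Aᵉ`-module `A^{⊗(k+2)}`, in which the first and the last tensor factor have been
collected into `Aᵉ`: the tensor `a₀ ⊗ a₁ ⊗ ⋯ ⊗ aₖ ⊗ aₖ₊₁` is `(a₀ ⊗ aₖ₊₁) ⊗ (a₁ ⊗ ⋯ ⊗ aₖ)`. -/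
abbrev Bar (k : ℕ) : Type _ := Env R A ⊗[R] (⨂[R] _ : Fin k, A)

/-- The pure tensor `a₀ ⊗ a₁ ⊗ ⋯ ⊗ aₖ ⊗ aₖ₊₁`. -/
def barTensor (k : ℕ) : MultilinearMap R (fun _ : Fin (k + 2) => A) (Bar R A k) where
  toFun a := (a 0 ⊗ₜ[R] MulOpposite.op (a (Fin.last _))) ⊗ₜ[R]
    PiTensorProduct.tprod R (fun j : Fin k => a j.castSucc.succ)
  map_update_add' {dec} m i x y := by
    cases Subsingleton.elim dec (instDecidableEqFin _)
    refine Fin.cases ?_ (fun i => Fin.lastCases ?_ (fun i => ?_) i) i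
    · have h (z : A) : (fun j : Fin k => Function.update m 0 z j.castSucc.succ) =
          fun j => m j.castSucc.succ := by
        ext j; rw [Function.update_of_ne (Fin.succ_ne_zero _)]
      have hl (z : A) : Function.update m 0 z (Fin.last (k + 1)) = m (Fin.last _) :=
        Function.update_of_ne (Fin.last_pos.ne') _ _
      simp only [h, hl, Function.update_self, TensorProduct.add_tmul]
    · have h (z : A) : (fun j : Fin k => Function.update m (Fin.last k).succ z j.castSucc.succ) =
          fun j => m j.castSucc.succ := by
        ext j; rw [Function.update_of_ne]; simp
      have h0 (z : A) : Function.update m (Fin.last k).succ z 0 = m 0 :=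
        Function.update_of_ne (Fin.succ_ne_zero _).symm _ _
      simp only [h, h0, ← Fin.succ_last, Function.update_self, TensorProduct.add_tmul,
        TensorProduct.tmul_add, MulOpposite.op_add]
    · have h (z : A) : (fun j : Fin k => Function.update m i.castSucc.succ z j.castSucc.succ) =
          Function.update (fun j => m j.castSucc.succ) i z := by
        ext j
        by_cases hj : j = i
        · subst hj; simp
        · rw [Function.update_of_ne hj, Function.update_of_ne]; simpa using hj
      have h0 (z : A) : Function.update m i.castSucc.succ z 0 = m 0 :=
        Function.update_of_ne (Fin.succ_ne_zero _).symm _ _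
      have hl (z : A) : Function.update m i.castSucc.succ z (Fin.last (k + 1)) =
          m (Fin.last _) :=
        Function.update_of_ne (by rw [← Fin.succ_last, Ne, Fin.succ_inj]; exact (Fin.castSucc_lt_last i).ne') _ _
      simp only [h, h0, hl, MultilinearMap.map_update_add, TensorProduct.tmul_add]
  map_update_smul' {dec} m i c x := by
    cases Subsingleton.elim dec (instDecidableEqFin _)
    refine Fin.cases ?_ (fun i => Fin.lastCases ?_ (fun i => ?_) i) i
    · have h (z : A) : (fun j : Fin k => Function.update m 0 z j.castSucc.succ) =
          fun j => m j.castSucc.succ := by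
        ext j; rw [Function.update_of_ne (Fin.succ_ne_zero _)]
      have hl (z : A) : Function.update m 0 z (Fin.last (k + 1)) = m (Fin.last _) :=
        Function.update_of_ne (Fin.last_pos.ne') _ _
      simp only [h, hl, Function.update_self, TensorProduct.smul_tmul']
    · have h (z : A) : (fun j : Fin k => Function.update m (Fin.last k).succ z j.castSucc.succ) =
          fun j => m j.castSucc.succ := by
        ext j; rw [Function.update_of_ne]; simp
      have h0 (z : A) : Function.update m (Fin.last k).succ z 0 = m 0 :=
        Function.update_of_ne (Fin.succ_ne_zero _).symm _ _
      simp only [h, h0, ← Fin.succ_last, Function.update_self, MulOpposite.op_smul,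
        TensorProduct.tmul_smul, TensorProduct.smul_tmul']
    · have h (z : A) : (fun j : Fin k => Function.update m i.castSucc.succ z j.castSucc.succ) =
          Function.update (fun j => m j.castSucc.succ) i z := by
        ext j
        by_cases hj : j = i
        · subst hj; simp
        · rw [Function.update_of_ne hj, Function.update_of_ne]; simpa using hj
      have h0 (z : A) : Function.update m i.castSucc.succ z 0 = m 0 :=
        Function.update_of_ne (Fin.succ_ne_zero _).symm _ _
      have hl (z : A) : Function.update m i.castSucc.succ z (Fin.last (k + 1)) =
          m (Fin.last _) :=
        Function.update_of_ne (by rw [← Fin.succ_last, Ne, Fin.succ_inj]; exact (Fin.castSucc_lt_last i).ne') _ _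
      simp only [h, h0, hl, MultilinearMap.map_update_smul, TensorProduct.tmul_smul]

theorem barTensor_apply (k : ℕ) (a : Fin (k + 2) → A) :
    barTensor R A k a = (a 0 ⊗ₜ[R] MulOpposite.op (a (Fin.last _))) ⊗ₜ[R]
      PiTensorProduct.tprod R (fun j : Fin k => a j.castSucc.succ) := rfl

theorem contractNth_update {k : ℕ} (i : Fin (k + 1)) (m : Fin (k + 2) → A) (j : Fin (k + 2)) :
    ∃ (p : Fin (k + 1)) (c : A →ₗ[R] A), ∀ z : A,
      i.castSucc.contractNth (· * ·) (Function.update m j z) =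
        Function.update (i.castSucc.contractNth (· * ·) m) p (c z) := by
  rcases lt_trichotomy j i.castSucc with h | h | h
  · refine ⟨j.castPred (h.trans_le (Fin.le_last _)).ne, LinearMap.id, fun z => ?_⟩
    ext q
    simp only [Fin.contractNth, Function.update_apply, Fin.ext_iff] at *
    simp at *
    grind
  · refine ⟨i, LinearMap.mulRight R (m i.succ), fun z => ?_⟩
    subst h
    ext q
    simp only [Fin.contractNth, Function.update_apply, Fin.ext_iff] at *
    simp at *
    grind
  · by_cases h' : j = i.succ
    · refine ⟨i, LinearMap.mulLeft R (m i.castSucc), fun z => ?_⟩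
      subst h'
      ext q
      simp only [Fin.contractNth, Function.update_apply, Fin.ext_iff] at *
      simp at *
      grind
    · refine ⟨j.pred (Fin.ne_zero_of_lt h), LinearMap.id, fun z => ?_⟩
      ext q
      simp only [Fin.contractNth, Function.update_apply, Fin.ext_iff] at *
      simp at *
      grind

variable {R A} in
/-- Multiplying two neighbouring arguments of a multilinear map keeps it multilinear. -/
def contractArgs {k : ℕ} {P : Type*} [AddCommMonoid P] [Module R P]
    (f : MultilinearMap R (fun _ : Fin (k + 1) => A) P) (i : Fin (k + 1)) :
    MultilinearMap R (fun _ : Fin (k + 2) => A) P where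
  toFun a := f (i.castSucc.contractNth (· * ·) a)
  map_update_add' {dec} m j x y := by
    cases Subsingleton.elim dec (instDecidableEqFin _)
    obtain ⟨p, c, h⟩ := contractNth_update R A i m j
    simp only [h, map_add, MultilinearMap.map_update_add]
  map_update_smul' {dec} m j r x := by
    cases Subsingleton.elim dec (instDecidableEqFin _)
    obtain ⟨p, c, h⟩ := contractNth_update R A i m j
    simp only [h, map_smul, MultilinearMap.map_update_smul]

variable {R A} in
/-- The `Aᵉ`-linear extension of an `R`-linear map. -/
def envLift {N P : Type*} [AddCommMonoid N] [Module R N] [AddCommMonoid P] [Module R P]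
    [Module (Env R A) P] [IsScalarTower R (Env R A) P] (f : N →ₗ[R] P) :
    Env R A ⊗[R] N →ₗ[Env R A] P :=
  haveI : SMulCommClass R (Env R A) P := IsScalarTower.to_smulCommClass
  TensorProduct.AlgebraTensorModule.lift
    (LinearMap.toSpanSingleton (Env R A) (N →ₗ[R] P) f)

variable {R A} in
@[simp]
theorem envLift_tmul {N P : Type*} [AddCommMonoid N] [Module R N] [AddCommMonoid P] [Module R P]
    [Module (Env R A) P] [IsScalarTower R (Env R A) P] (f : N →ₗ[R] P) (e : Env R A) (x : N) :
    envLift f (e ⊗ₜ[R] x) = e • f x := rfl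

/-- The right-hand side of the formula
`bₖ₊₁ (a₀ ⊗ ⋯ ⊗ aₖ₊₂) = ∑ i ≤ k+1, (-1)ⁱ a₀ ⊗ ⋯ ⊗ aᵢ aᵢ₊₁ ⊗ ⋯ ⊗ aₖ₊₂`. -/
def barFormula (k : ℕ) : MultilinearMap R (fun _ : Fin (k + 3) => A) (Bar R A k) :=
  ∑ i : Fin (k + 2), (-1 : R) ^ (i : ℕ) • contractArgs (barTensor R A k) i

/-- The differential `bₖ₊₁ : A^{⊗(k+3)} → A^{⊗(k+2)}` of the bar resolution, as the `Aᵉ`-linear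
map that is given by `barFormula` on the tensors `1 ⊗ a₁ ⊗ ⋯ ⊗ aₖ₊₁ ⊗ 1`. -/
def barD (k : ℕ) : Bar R A (k + 1) →ₗ[Env R A] Bar R A k :=
  envLift (PiTensorProduct.lift
    ((LinearMap.applyₗ (1 : A)).compMultilinearMap ((barFormula R A k).curryLeft 1).curryRight))

/-- The augmentation `b₀ : A ⊗ A → A` of the bar resolution. -/
def barAug : Bar R A 0 →ₗ[Env R A] RegBimod R A :=
  envLift (PiTensorProduct.lift
    (MultilinearMap.constOfIsEmpty R (fun _ : Fin 0 => A) (RegBimod.of R (1 : A))))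

theorem env_smul_barTensor (k : ℕ) (α β : A) (a : Fin (k + 2) → A) :
    (α ⊗ₜ[R] MulOpposite.op β : Env R A) • barTensor R A k a =
      barTensor R A k
        (Function.update (Function.update a 0 (α * a 0)) (Fin.last _) (a (Fin.last _) * β)) := by
  have h : (fun j : Fin k => Function.update (Function.update a 0 (α * a 0)) (Fin.last _)
      (a (Fin.last _) * β) j.castSucc.succ) = fun j => a j.castSucc.succ := by
    ext j
    rw [Function.update_of_ne, Function.update_of_ne (Fin.succ_ne_zero _)]
    rw [← Fin.succ_last, Ne, Fin.succ_inj]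
    exact (Fin.castSucc_lt_last j).ne
  have h0 : (0 : Fin (k + 2)) ≠ Fin.last _ := Fin.last_pos.ne
  simp only [barTensor_apply, h, Function.update_self, Function.update_of_ne h0,
    TensorProduct.smul_tmul', smul_eq_mul, Algebra.TensorProduct.tmul_mul_tmul,
    MulOpposite.op_mul]

/-- The formula for the differential of the bar resolution, on all pure tensors. -/
theorem barD_tensor (k : ℕ) (a : Fin (k + 3) → A) :
    barD R A k (barTensor R A (k + 1) a) =
      ∑ i : Fin (k + 2), (-1 : R) ^ (i : ℕ) •
        barTensor R A k (i.castSucc.contractNth (· * ·) a) := by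
  have key : barD R A k (barTensor R A (k + 1) a) =
      (a 0 ⊗ₜ[R] MulOpposite.op (a (Fin.last _)) : Env R A) • ∑ i : Fin (k + 2),
        (-1 : R) ^ (i : ℕ) • barTensor R A k (i.castSucc.contractNth (· * ·)
          (Fin.cons 1 (Fin.snoc (fun j : Fin (k + 1) => a j.castSucc.succ) 1 : _ → A) :
            Fin (k + 3) → A)) := by
    rw [barTensor_apply, barD, envLift_tmul, PiTensorProduct.lift.tprod]
    simp [barFormula, contractArgs, sum_apply]
  rw [key, Finset.smul_sum]
  refine Finset.sum_congr rfl fun i _ => ?_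
  rw [smul_comm, env_smul_barTensor]
  congr 2
  ext q
  have h1 (j : Fin (k + 3)) : (Fin.cons 1 (Fin.snoc (fun j : Fin (k + 1) => a j.castSucc.succ) 1 :
      _ → A) : Fin (k + 3) → A) j =
      if j = 0 then 1 else if j = Fin.last _ then 1 else a j := by
    refine Fin.cases ?_ (fun j => Fin.lastCases ?_ (fun j => ?_) j) j
    · simp
    · simp
    · have h : j.castSucc.succ ≠ Fin.last (k + 2) := by
        rw [← Fin.succ_last, Ne, Fin.succ_inj]
        exact (Fin.castSucc_lt_last j).ne
      rw [if_neg (Fin.succ_ne_zero _), if_neg h]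
      simp
  have hi := i.2
  have hq := q.2
  simp only [Fin.contractNth, Function.update_apply, h1, Fin.ext_iff, Fin.val_last, Fin.val_zero,
    Fin.val_castSucc, Fin.val_succ]
  split_ifs
  all_goals first
    | omega
    | contradiction
    | rfl
    | (simp only [one_mul, mul_one]; done)
    | (obtain rfl : q = Fin.last _ := Fin.ext (by assumption)
       simp only [one_mul, mul_one]
       rfl)
    | (obtain rfl : q = 0 := Fin.ext (by assumption)
       simp only [one_mul, mul_one]
       rfl)

theorem barAug_tensor (a : Fin 2 → A) :
    barAug R A (barTensor R A 0 a) = RegBimod.of R (a 0 * a 1) := by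
  rw [barTensor_apply, barAug, envLift_tmul, PiTensorProduct.lift.tprod]
  simp [env_smul_of]

end Bar

/-! ### The exterior algebra, its bar digraph and the matching -/

section Exterior

variable (R : Type*) [CommRing R] (n : ℕ)

/-- The exterior algebra `Λ[x₁, …, xₙ] = Λ(Rⁿ)`. -/
abbrev ExtAlg : Type _ := ExteriorAlgebra R (Fin n → R)

/-- The generator `xᵢ`. -/
def extX (i : Fin n) : ExtAlg R n := ExteriorAlgebra.ι R (Pi.single i 1)

/-- The `R`-basis of `Λ[x₁, …, xₙ]` of the increasing monomials `x_σ`, `σ ⊆ [n]`. -/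
def extBasis : Module.Basis (Finset (Fin n)) R (ExtAlg R n) :=
  (Pi.basisFun R (Fin n)).ExteriorAlgebra

theorem extBasis_apply (σ : Finset (Fin n)) :
    extBasis R n σ = ((σ.sort (· ≤ ·)).map (extX R n)).prod := by
  rw [extBasis, ExteriorAlgebra.basis_apply]
  change ExteriorAlgebra.ιMulti R σ.card
    (⇑(Pi.basisFun R (Fin n)) ∘ ⇑(σ.orderEmbOfFin rfl)) = _
  rw [ExteriorAlgebra.ιMulti_apply]
  congr 1
  refine List.ext_getElem (by simp) fun j h1 h2 => ?_
  simp [extX, Finset.orderEmbOfFin_apply]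

/-- The `Aᵉ`-basis `1 ⊗ x_{σ₁} ⊗ ⋯ ⊗ x_{σₖ} ⊗ 1` of the term `A^{⊗(k+2)}` of the bar resolution
of the exterior algebra. -/
def barBasis (k : ℕ) :
    Module.Basis (Fin k → Finset (Fin n)) (Env R (ExtAlg R n)) (Bar R (ExtAlg R n) k) :=
  Algebra.TensorProduct.basis (Env R (ExtAlg R n))
    (Basis.piTensorProduct (fun _ : Fin k => extBasis R n))

theorem barBasis_apply (k : ℕ) (v : Fin k → Finset (Fin n)) :
    barBasis R n k v = barTensor R (ExtAlg R n) k
      (Fin.cons 1 (Fin.snoc (fun j => extBasis R n (v j)) 1 : Fin (k + 1) → ExtAlg R n)) := by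
  rw [barBasis, Algebra.TensorProduct.basis_apply, Basis.piTensorProduct_apply, barTensor_apply,
    Algebra.TensorProduct.one_def]
  congr 2
  · rw [← Fin.succ_last, Fin.cons_succ, Fin.snoc_last]
    rfl
  · ext j
    simp

/-- The matrix entries of the differential of the bar resolution in the bases `barBasis`. -/
def barEntry (k : ℕ) (v : Fin (k + 1) → Finset (Fin n)) (w : Fin k → Finset (Fin n)) :
    Env R (ExtAlg R n) :=
  (barBasis R n k).repr (barD R (ExtAlg R n) k (barBasis R n (k + 1) v)) w

/-- The basis elements `1 ⊗ x_{σ₁} ⊗ ⋯ ⊗ x_{σₖ} ⊗ 1`, all `σⱼ` nonempty, of the normalized bar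
resolution, i.e. of the quotient of the bar resolution by the subcomplex that is spanned by the
basis elements with some `x_{σⱼ} = 1`. -/
abbrev NCell (k : ℕ) : Type := Fin k → {σ : Finset (Fin n) // σ.Nonempty}

/-- The matrix entries of the differential of the normalized bar resolution. -/
def nbarEntry (k : ℕ) (v : NCell n (k + 1)) (w : NCell n k) : Env R (ExtAlg R n) :=
  barEntry R n k (fun j => (v j).1) (fun j => (w j).1)

/-- The matching: its edges go from
`1 ⊗ x_{i₁} ⊗ ⋯ ⊗ x_{iᵣ₋₁} ⊗ xᵢ ⊗ x_{σᵣ ∖ {i}} ⊗ x_{σᵣ₊₁} ⊗ ⋯ ⊗ x_{σₖ} ⊗ 1` to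
`1 ⊗ x_{i₁} ⊗ ⋯ ⊗ x_{iᵣ₋₁} ⊗ x_{σᵣ} ⊗ x_{σᵣ₊₁} ⊗ ⋯ ⊗ x_{σₖ} ⊗ 1`, where
`i₁ ≤ ⋯ ≤ iᵣ₋₁ ≤ i = max σᵣ`. -/
def barMatching (k : ℕ) (v : NCell n (k + 1)) (w : NCell n k) : Prop :=
  ∃ (l : List (Fin n)) (i : Fin n) (σ : Finset (Fin n)) (t : List (Finset (Fin n))),
    (l ++ [i]).Pairwise (· ≤ ·) ∧ IsGreatest (σ : Set (Fin n)) i ∧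
    List.ofFn (fun j => (v j).1) = l.map (fun a => {a}) ++ {i} :: σ.erase i :: t ∧
    List.ofFn (fun j => (w j).1) = l.map (fun a => {a}) ++ σ :: t

/-- For a multiset `τ = {i₁ ≤ ⋯ ≤ iₖ}`, the basis element `1 ⊗ x_{i₁} ⊗ ⋯ ⊗ x_{iₖ} ⊗ 1`. -/
def critCell (k : ℕ) (τ : Sym (Fin n) k) : NCell n k := fun j =>
  ⟨{((τ : Multiset (Fin n)).sort (· ≤ ·))[(j : ℕ)]'(by
      rw [Multiset.length_sort]; exact j.2.trans_eq τ.2.symm)}, Finset.singleton_nonempty _⟩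

/-! ### The resolution -/

/-- The free `Aᵉ`-module on the symbols `x_(τ)`, for `τ` a `k`-element multisubset of `[n]`. -/
abbrev MRes (k : ℕ) : Type _ := Sym (Fin n) k →₀ Env R (ExtAlg R n)

/-- The coefficient `xᵢ ⊗ 1 + (-1)ᵏ 1 ⊗ xᵢ`. -/
def mresCoeff (k : ℕ) (i : Fin n) : Env R (ExtAlg R n) :=
  extX R n i ⊗ₜ[R] 1 + (-1 : R) ^ k • (1 ⊗ₜ[R] MulOpposite.op (extX R n i))

/-- The differential from degree `k + 1` to degree `k`:
`x_(τ) ↦ ∑ i ∈ τ̄, (xᵢ ⊗ 1 + (-1)ᵏ⁺¹ 1 ⊗ xᵢ) x_(τ ∖ {i})`. -/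
def mresD (k : ℕ) : MRes R n (k + 1) →ₗ[Env R (ExtAlg R n)] MRes R n k :=
  Finsupp.linearCombination (Env R (ExtAlg R n)) fun τ : Sym (Fin n) (k + 1) =>
    ∑ i : {i // i ∈ (τ : Multiset (Fin n)).toFinset},
      Finsupp.single (τ.erase i.1 (Multiset.mem_toFinset.1 i.2)) (mresCoeff R n (k + 1) i.1)

/-- The augmentation `Aᵉ x_(∅) → A`, `x_(∅) ↦ 1`. -/
def mresAug : MRes R n 0 →ₗ[Env R (ExtAlg R n)] RegBimod R (ExtAlg R n) :=
  Finsupp.linearCombination (Env R (ExtAlg R n)) fun _ => RegBimod.of R (1 : ExtAlg R n)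

end Exterior

end

/-!
Write `A = Λ(Rⁿ)`, with its monomial basis `x_σ`, and consider the basis `x_σ ⊗ x_ρ` of `Aᵉ`.

*Exactness.* The part of the differential of `MRes` that multiplies by `xᵢ ⊗ 1` is the differential
of a Koszul complex in the left tensor factor. It has an explicit contraction `mresHtpy`, which
moves the greatest exterior factor into the divided power part. The other part of the differential
multiplies by `± 1 ⊗ xᵢ` and raises the degree in the right tensor factor. Subtracting from a cycle
the boundary of its contraction therefore raises that degree, which is at most `n`, so that
finitely many corrections exhibit the cycle as a boundary (`le_range_of_approx`). In degree zero the
contraction misses the terms that are constant in the left factor; on the kernel of the augmentation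
these have higher degree in the right factor as well (`const_mem_of_aug_eq_zero`).

*Minimality.* The coefficients `xᵢ ⊗ 1 ± 1 ⊗ xᵢ` raise the total degree of `Aᵉ`, which is at most
`2 n`. This gives Nakayama's lemma for the images, and nilpotent matrix entries.

*Homotopy equivalence.* The bar resolution is free and contractible over `R`
(`isFreeResolution_bar`), and two free resolutions of one module are homotopy equivalent over it
(`IsFreeResolution.areHomotopyEquivalentOver`).

*The matching.* A basis element is a list `σ₁, …, σₖ` of nonempty sets, and the edges of the
digraph delete the first or the last set or merge two disjoint neighbours (`nbarEntry_cases`). The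
number of letters and the number of non-inversions (pairs `a ≤ b` with `a` in an earlier set than
`b`) never increase along an edge of the differential and are constant on the matching. When both
stay constant along an unmatched edge of the differential that ends in a target of the matching, the
edge also starts in such a target (`ListMatch.of_merge`), whereas a reversed edge leaves the set of
targets. Hence `listPotential` strictly decreases along all edges of `Γ^M`, which excludes cycles
and infinite paths.

*Sums over paths.* A path from `x_(τ)` to `x_(τ')` drops one degree in total. As the number of
letters does not increase and all sets are nonempty, it can only visit words in the letters of `τ`
and merges of two neighbouring letters of such words, before its last edge deletes the first or the
last letter. Every pair of steps between words replaces a word by the one in which two neighbouring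
letters are exchanged, creating a first descent; the target word determines the pair, and the
product of its two weights is `1`. So each word in the letters of `τ` is reached along exactly one
path, of weight `1` (`path_unique`, `exists_path_weight_eq_one`). The words with an edge to
`x_(τ')` are `i, τ'` and `τ', i`, of weights `xᵢ ⊗ 1` and `(-1)ᵏ⁺¹ 1 ⊗ xᵢ`, where `τ = τ' ∪ {i}`;
their sum is the entry of the differential (`mresD_single_eq_sum`).
-/

/-! ### Products of monomials in the exterior algebra -/

section Monomials

variable (R : Type*) [CommRing R] {n : ℕ}

theorem extX_sq (i : Fin n) : extX R n i * extX R n i = 0 :=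
  ExteriorAlgebra.ι_sq_zero _

theorem extX_anticomm (i j : Fin n) : extX R n i * extX R n j = -(extX R n j * extX R n i) :=
  eq_neg_of_add_eq_zero_left (ExteriorAlgebra.ι_add_mul_swap _ _)

/-- Reordering the factors of a product of generators changes at most its sign. -/
theorem exists_sign_of_perm {l l' : List (Fin n)} (h : l.Perm l') :
    ∃ s : ℤˣ, (l.map (extX R n)).prod = s • (l'.map (extX R n)).prod := by
  induction h with
  | nil => exact ⟨1, by simp⟩
  | cons a _ ih =>
    obtain ⟨s, hs⟩ := ih
    exact ⟨s, by simp [hs, mul_smul_comm]⟩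
  | swap a b l =>
    exact ⟨-1, by simp [← mul_assoc, extX_anticomm R b a]⟩
  | trans _ _ ih₁ ih₂ =>
    obtain ⟨s, hs⟩ := ih₁
    obtain ⟨t, ht⟩ := ih₂
    exact ⟨s * t, by rw [hs, ht, mul_smul]⟩

theorem prod_extX_eq_zero {l : List (Fin n)} (h : ¬ l.Nodup) : (l.map (extX R n)).prod = 0 := by
  rw [List.nodup_iff_sublist] at h
  push Not at h
  obtain ⟨a, ha⟩ := h
  obtain ⟨l', hl'⟩ := ha.exists_perm_append
  obtain ⟨s, hs⟩ := exists_sign_of_perm R hl'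
  rw [hs]
  simp [← mul_assoc, extX_sq]

theorem exists_sign_prod_extX {l : List (Fin n)} (h : l.Nodup) :
    ∃ s : ℤˣ, (l.map (extX R n)).prod = s • extBasis R n l.toFinset := by
  rw [extBasis_apply]
  exact exists_sign_of_perm R
    (((l.toFinset.sort_perm_toList (· ≤ ·)).trans (List.toFinset_toList h)).symm)

theorem extBasis_mul_of_disjoint {σ τ : Finset (Fin n)} (h : Disjoint σ τ) :
    ∃ s : ℤˣ, extBasis R n σ * extBasis R n τ = s • extBasis R n (σ ∪ τ) := by
  have hn : (σ.sort (· ≤ ·) ++ τ.sort (· ≤ ·)).Nodup := by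
    rw [List.nodup_append']
    refine ⟨σ.sort_nodup _, τ.sort_nodup _, fun x hx hy => ?_⟩
    exact Finset.disjoint_left.1 h (by simpa using hx) (by simpa using hy)
  obtain ⟨s, hs⟩ := exists_sign_prod_extX R hn
  refine ⟨s, ?_⟩
  rw [extBasis_apply R n σ, extBasis_apply R n τ, ← List.prod_append, ← List.map_append, hs]
  simp

theorem extBasis_mul_of_not_disjoint {σ τ : Finset (Fin n)} (h : ¬ Disjoint σ τ) :
    extBasis R n σ * extBasis R n τ = 0 := by
  rw [extBasis_apply R n σ, extBasis_apply R n τ, ← List.prod_append, ← List.map_append]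
  refine prod_extX_eq_zero R fun hn => h ?_
  rw [List.nodup_append'] at hn
  exact Finset.disjoint_left.2 fun x hx hy =>
    hn.2.2 ((Finset.mem_sort _).2 hx) ((Finset.mem_sort _).2 hy)

@[simp]
theorem extBasis_empty : extBasis R n ∅ = 1 := by simp [extBasis_apply]

@[simp]
theorem extBasis_singleton (i : Fin n) : extBasis R n {i} = extX R n i := by
  simp [extBasis_apply]

/-- Appending a factor that is larger than all factors of an increasing monomial. -/
theorem extBasis_mul_extX {σ : Finset (Fin n)} {i : Fin n} (h : ∀ a ∈ σ, a < i) :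
    extBasis R n σ * extX R n i = extBasis R n (insert i σ) := by
  rw [extBasis_apply R n σ, extBasis_apply R n (insert i σ)]
  have : (insert i σ).sort (· ≤ ·) = σ.sort (· ≤ ·) ++ [i] := by
    have hp : ((insert i σ).sort (· ≤ ·)).Perm (σ.sort (· ≤ ·) ++ [i]) := by
      refine (List.perm_ext_iff_of_nodup (Finset.sort_nodup _ _) ?_).2 fun a => ?_
      · rw [List.nodup_append']
        exact ⟨σ.sort_nodup _, by simp, by simpa using fun hi => (h i hi).false⟩
      · simp [or_comm]
    refine hp.eq_of_pairwise' (r := (· ≤ ·)) (Finset.pairwise_sort _ _) ?_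
    rw [List.pairwise_append]
    exact ⟨Finset.pairwise_sort _ _, by simp, by simpa using fun a ha => (h a ha).le⟩
  simp [this]

end Monomials

/-! ### Degree filtrations of the enveloping algebra -/

section Filtration

variable (R : Type*) [CommRing R] (n : ℕ)

/-- The span in `Aᵉ` of the tensors `x_σ ⊗ x_ρ` of weighted degree at least `p`, where `x_σ ⊗ x_ρ`
has weighted degree `a |σ| + |ρ|`. Only the weights `a = 1` (total degree) and `a = 0` (degree of
the right factor) are used. -/
def envFil (a p : ℕ) : Submodule R (Env R (ExtAlg R n)) :=
  Submodule.span R {e | ∃ σ ρ : Finset (Fin n), p ≤ a * σ.card + ρ.card ∧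
    e = extBasis R n σ ⊗ₜ[R] MulOpposite.op (extBasis R n ρ)}

variable {R n}

theorem tmul_mem_envFil {a p : ℕ} {σ ρ : Finset (Fin n)} (h : p ≤ a * σ.card + ρ.card) :
    extBasis R n σ ⊗ₜ[R] MulOpposite.op (extBasis R n ρ) ∈ envFil R n a p :=
  Submodule.subset_span ⟨σ, ρ, h, rfl⟩

theorem extBasis_mul_cases (σ τ : Finset (Fin n)) :
    extBasis R n σ * extBasis R n τ = 0 ∨
      ∃ s : ℤˣ, (σ ∪ τ).card = σ.card + τ.card ∧
        extBasis R n σ * extBasis R n τ = s • extBasis R n (σ ∪ τ) := by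
  by_cases h : Disjoint σ τ
  · obtain ⟨s, hs⟩ := extBasis_mul_of_disjoint R h
    exact .inr ⟨s, Finset.card_union_of_disjoint h, hs⟩
  · exact .inl (extBasis_mul_of_not_disjoint R h)

theorem mul_mem_envFil {a p q : ℕ} {e f : Env R (ExtAlg R n)} (he : e ∈ envFil R n a p)
    (hf : f ∈ envFil R n a q) : e * f ∈ envFil R n a (p + q) := by
  have : envFil R n a p * envFil R n a q ≤ envFil R n a (p + q) := by
    rw [envFil, envFil, Submodule.span_mul_span, Submodule.span_le]
    rintro _ ⟨_, ⟨σ, ρ, h, rfl⟩, _, ⟨σ', ρ', h', rfl⟩, rfl⟩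
    simp only [SetLike.mem_coe, Algebra.TensorProduct.tmul_mul_tmul, ← MulOpposite.op_mul]
    obtain h1 | ⟨s, hs, h1⟩ := extBasis_mul_cases (R := R) σ σ'
    · simp [h1]
    obtain h2 | ⟨t, ht, h2⟩ := extBasis_mul_cases (R := R) ρ' ρ
    · simp [h2]
    have : extBasis R n (σ ∪ σ') ⊗ₜ[R] MulOpposite.op (extBasis R n (ρ' ∪ ρ)) ∈
        envFil R n a (p + q) := tmul_mem_envFil (by rw [hs, ht]; linarith)
    rw [h1, h2]
    rcases Int.units_eq_one_or s with rfl | rfl <;> rcases Int.units_eq_one_or t with rfl | rfl <;>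
      simpa [TensorProduct.neg_tmul, TensorProduct.tmul_neg]
  exact this (Submodule.mul_mem_mul he hf)

variable (R n) in
/-- The `R`-basis `x_σ ⊗ x_ρ` of `Aᵉ`. -/
noncomputable def envBasis :
    Module.Basis (Finset (Fin n) × Finset (Fin n)) R (Env R (ExtAlg R n)) :=
  (extBasis R n).tensorProduct ((extBasis R n).map (MulOpposite.opLinearEquiv R))

theorem envBasis_apply (σ ρ : Finset (Fin n)) : envBasis R n (σ, ρ) =
    extBasis R n σ ⊗ₜ[R] MulOpposite.op (extBasis R n ρ) := by
  simp [envBasis]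

theorem mem_envFil_zero (a : ℕ) (e : Env R (ExtAlg R n)) : e ∈ envFil R n a 0 := by
  have : envFil R n a 0 = ⊤ := by
    rw [eq_top_iff, ← (envBasis R n).span_eq, Submodule.span_le]
    rintro _ ⟨⟨σ, ρ⟩, rfl⟩
    rw [envBasis_apply]
    exact tmul_mem_envFil (Nat.zero_le _)
  rw [this]
  trivial

theorem envFil_eq_bot {a p : ℕ} (h : a * n + n < p) : envFil R n a p = ⊥ := by
  rw [envFil, Submodule.span_eq_bot]
  rintro _ ⟨σ, ρ, h', rfl⟩
  have h1 : σ.card ≤ n := card_finset_fin_le σ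
  have h2 : ρ.card ≤ n := card_finset_fin_le ρ
  have := Nat.mul_le_mul_left a h1
  omega

theorem extX_tmul_one_mem (a : ℕ) (i : Fin n) :
    (extX R n i ⊗ₜ[R] 1 : Env R (ExtAlg R n)) ∈ envFil R n a a := by
  simpa using tmul_mem_envFil (R := R) (n := n) (a := a) (p := a) (σ := {i}) (ρ := ∅) (by simp)

theorem one_tmul_extX_mem (a : ℕ) (i : Fin n) :
    (1 ⊗ₜ[R] MulOpposite.op (extX R n i) : Env R (ExtAlg R n)) ∈ envFil R n a 1 := by
  simpa using tmul_mem_envFil (R := R) (n := n) (a := a) (p := 1) (σ := ∅) (ρ := {i}) (by simp)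

theorem mresCoeff_mem (k : ℕ) (i : Fin n) : mresCoeff R n k i ∈ envFil R n 1 1 :=
  add_mem (extX_tmul_one_mem 1 i) (Submodule.smul_mem _ _ (one_tmul_extX_mem 1 i))

end Filtration

/-! ### The contraction of the left Koszul complex -/

section Contraction

variable (R : Type*) [CommRing R] {n : ℕ}

open Classical in
/-- The `R`-linear map that removes the last factor `x_j` from the increasing monomials ending
in `x_j` and kills all other monomials. -/
noncomputable def extStrip (j : Fin n) : ExtAlg R n →ₗ[R] ExtAlg R n :=
  (extBasis R n).constr R fun σ =>
    if IsGreatest (σ : Set (Fin n)) j then extBasis R n (σ.erase j) else 0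

/-- The augmentation `Λ → R`, followed by the inclusion `R → Λ`. -/
noncomputable def extConst : ExtAlg R n →ₗ[R] ExtAlg R n :=
  (extBasis R n).constr R fun σ => if σ = ∅ then 1 else 0

variable {R}

theorem extStrip_of_isGreatest {j : Fin n} {σ : Finset (Fin n)}
    (h : IsGreatest (σ : Set (Fin n)) j) :
    extStrip R j (extBasis R n σ) = extBasis R n (σ.erase j) := by
  rw [extStrip, Module.Basis.constr_basis, if_pos h]

theorem extStrip_of_not_isGreatest {j : Fin n} {σ : Finset (Fin n)}
    (h : ¬ IsGreatest (σ : Set (Fin n)) j) : extStrip R j (extBasis R n σ) = 0 := by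
  rw [extStrip, Module.Basis.constr_basis, if_neg h]

theorem extBasis_erase_mul {j : Fin n} {σ : Finset (Fin n)}
    (h : IsGreatest (σ : Set (Fin n)) j) :
    extBasis R n (σ.erase j) * extX R n j = extBasis R n σ := by
  rw [extBasis_mul_extX, Finset.insert_erase h.1]
  intro a ha
  rw [Finset.mem_erase] at ha
  exact lt_of_le_of_ne (h.2 ha.2) ha.1

theorem extBasis_mul_extX_of_mem {i : Fin n} {σ : Finset (Fin n)} (h : i ∈ σ) :
    extBasis R n σ * extX R n i = 0 := by
  rw [← extBasis_singleton, extBasis_mul_of_not_disjoint]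
  simpa using h

theorem extBasis_mul_extX_of_notMem {i : Fin n} {σ : Finset (Fin n)} (h : i ∉ σ) :
    ∃ s : ℤˣ, extBasis R n σ * extX R n i = s • extBasis R n (insert i σ) := by
  rw [← extBasis_singleton]
  obtain ⟨s, hs⟩ := extBasis_mul_of_disjoint R (σ := σ) (τ := {i}) (by simpa using h)
  exact ⟨s, by rw [hs, Finset.union_comm]; rfl⟩

theorem extStrip_intUnits_smul (j : Fin n) (s : ℤˣ) (a : ExtAlg R n) :
    extStrip R j (s • a) = s • extStrip R j a := by
  rcases Int.units_eq_one_or s with rfl | rfl <;> simp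

theorem extStrip_mul_of_lt {i m : Fin n} (h : i < m) (a : ExtAlg R n) :
    extStrip R m (a * extX R n i) = -(extStrip R m a * extX R n i) := by
  suffices H : extStrip R m ∘ₗ LinearMap.mulRight R (extX R n i) =
      -(LinearMap.mulRight R (extX R n i) ∘ₗ extStrip R m) from LinearMap.congr_fun H a
  refine (extBasis R n).ext fun σ => ?_
  simp only [LinearMap.comp_apply, LinearMap.neg_apply, LinearMap.mulRight_apply]
  by_cases hm : IsGreatest (σ : Set (Fin n)) m
  · have hlt : ∀ a ∈ σ.erase m, a < m := fun a ha => by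
      rw [Finset.mem_erase] at ha
      exact lt_of_le_of_ne (hm.2 ha.2) ha.1
    rw [extStrip_of_isGreatest hm]
    by_cases hi : i ∈ σ
    · rw [extBasis_mul_extX_of_mem hi,
        extBasis_mul_extX_of_mem (Finset.mem_erase.2 ⟨h.ne, hi⟩)]
      simp
    · obtain ⟨s, hs⟩ := extBasis_mul_extX_of_notMem (R := R) (σ := σ.erase m) (i := i)
        (fun h' => hi (Finset.mem_of_mem_erase h'))
      have h1 : extBasis R n σ * extX R n i = -(s • extBasis R n (insert i σ)) := by
        have hg : IsGreatest ((insert i σ : Finset (Fin n)) : Set (Fin n)) m := by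
          refine ⟨by simp [hm.1], ?_⟩
          rw [Finset.coe_insert]
          rintro x (rfl | hx)
          · exact h.le
          · exact hm.2 hx
        rw [← extBasis_erase_mul hm, ← extBasis_erase_mul hg, mul_assoc, extX_anticomm, mul_neg,
          ← mul_assoc, hs, Finset.erase_insert_of_ne h.ne, smul_mul_assoc]
      rw [h1, hs, map_neg, extStrip_intUnits_smul, extStrip_of_isGreatest,
        Finset.erase_insert_of_ne h.ne]
      refine ⟨by simp [hm.1], ?_⟩
      rw [Finset.coe_insert]
      rintro x (rfl | hx)
      · exact h.le
      · exact hm.2 hx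
  · rw [extStrip_of_not_isGreatest hm, zero_mul, neg_zero]
    by_cases hi : i ∈ σ
    · rw [extBasis_mul_extX_of_mem hi, map_zero]
    · obtain ⟨s, hs⟩ := extBasis_mul_extX_of_notMem (R := R) hi
      rw [hs, extStrip_intUnits_smul, extStrip_of_not_isGreatest, smul_zero]
      rintro ⟨h1, h2⟩
      rw [Finset.coe_insert] at h1 h2
      refine hm ⟨h1.resolve_left h.ne', fun x hx => h2 (Set.mem_insert_of_mem _ hx)⟩

theorem extStrip_mul_of_gt {i m : Fin n} (h : m < i) (a : ExtAlg R n) :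
    extStrip R m (a * extX R n i) = 0 := by
  suffices H : extStrip R m ∘ₗ LinearMap.mulRight R (extX R n i) = 0 from LinearMap.congr_fun H a
  refine (extBasis R n).ext fun σ => ?_
  simp only [LinearMap.comp_apply, LinearMap.zero_apply, LinearMap.mulRight_apply]
  by_cases hi : i ∈ σ
  · rw [extBasis_mul_extX_of_mem hi, map_zero]
  · obtain ⟨s, hs⟩ := extBasis_mul_extX_of_notMem (R := R) hi
    rw [hs, extStrip_intUnits_smul, extStrip_of_not_isGreatest, smul_zero]
    rintro ⟨h1, h2⟩
    exact (h2 (by simp : i ∈ _)).not_gt h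

theorem extStrip_extBasis_mul (i : Fin n) (σ : Finset (Fin n))
    [Decidable (IsGreatest (σ : Set (Fin n)) i)] :
    extStrip R i (extBasis R n σ) * extX R n i =
      if IsGreatest (σ : Set (Fin n)) i then extBasis R n σ else 0 := by
  split_ifs with h
  · rw [extStrip_of_isGreatest h, extBasis_erase_mul h]
  · rw [extStrip_of_not_isGreatest h, zero_mul]

/-- Each monomial other than `1` loses and regains exactly its greatest factor. -/
theorem sum_extStrip_mul (a : ExtAlg R n) :
    ∑ i, extStrip R i a * extX R n i = a - extConst R a := by
  classical
  suffices H : ∑ i, LinearMap.mulRight R (extX R n i) ∘ₗ extStrip R i =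
      LinearMap.id - extConst R by
    simpa using LinearMap.congr_fun H a
  refine (extBasis R n).ext fun σ => ?_
  simp only [LinearMap.sum_apply, LinearMap.comp_apply, LinearMap.mulRight_apply,
    extStrip_extBasis_mul, LinearMap.sub_apply, LinearMap.id_apply, extConst,
    Module.Basis.constr_basis]
  rcases σ.eq_empty_or_nonempty with rfl | hσ
  · simp [IsGreatest]
  · rw [if_neg hσ.ne_empty, sub_zero, Finset.sum_eq_single (σ.max' hσ),
      if_pos (Finset.isGreatest_max' σ hσ)]
    · intro i _ hi
      exact if_neg fun h => hi (h.unique (Finset.isGreatest_max' σ hσ))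
    · simp

/-- If the greatest factor of a monomial is at least `x_m`, the sum returns the monomial and the
second term vanishes. Otherwise the sum vanishes and `x_m` is appended and removed again. -/
theorem sum_extStrip_mul_add (m : Fin n) (a : ExtAlg R n) :
    ∑ i ∈ Finset.univ.filter (m ≤ ·), extStrip R i a * extX R n i +
      extStrip R m (a * extX R n m) = a := by
  classical
  suffices H : ∑ i ∈ Finset.univ.filter (m ≤ ·),
        LinearMap.mulRight R (extX R n i) ∘ₗ extStrip R i +
      extStrip R m ∘ₗ LinearMap.mulRight R (extX R n m) = LinearMap.id by
    simpa using LinearMap.congr_fun H a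
  refine (extBasis R n).ext fun σ => ?_
  simp only [LinearMap.sum_apply, LinearMap.comp_apply, LinearMap.mulRight_apply,
    extStrip_extBasis_mul, LinearMap.add_apply, LinearMap.id_apply]
  by_cases hσ : ∀ a ∈ σ, a < m
  · have hg : IsGreatest ((insert m σ : Finset (Fin n)) : Set (Fin n)) m := by
      refine ⟨by simp, ?_⟩
      rw [Finset.coe_insert]
      rintro x (rfl | hx)
      · exact le_rfl
      · exact (hσ x hx).le
    rw [extBasis_mul_extX R hσ, extStrip_of_isGreatest hg,
      Finset.erase_insert fun h => (hσ m h).false, Finset.sum_eq_zero, zero_add]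
    intro i hi
    exact if_neg fun h => ((hσ i h.1).trans_le (Finset.mem_filter.1 hi).2).false
  · push Not at hσ
    obtain ⟨b, hb, hmb⟩ := hσ
    have hne : σ.Nonempty := ⟨b, hb⟩
    have hM := Finset.isGreatest_max' σ hne
    have h0 : extStrip R m (extBasis R n σ * extX R n m) = 0 := by
      by_cases hm : m ∈ σ
      · rw [extBasis_mul_extX_of_mem hm, map_zero]
      · obtain ⟨s, hs⟩ := extBasis_mul_extX_of_notMem (R := R) hm
        rw [hs, extStrip_intUnits_smul, extStrip_of_not_isGreatest, smul_zero]
        rintro ⟨h1, h2⟩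
        exact hm (le_antisymm hmb (h2 (by simp [hb] : b ∈ _)) ▸ hb)
    rw [h0, add_zero, Finset.sum_eq_single (σ.max' hne), if_pos hM]
    · intro i _ hi
      exact if_neg fun h => hi (h.unique hM)
    · intro h
      exact absurd (Finset.mem_filter.2 ⟨Finset.mem_univ _, hmb.trans (hM.2 hb)⟩) h

end Contraction

section EnvContraction

variable {R : Type*} [CommRing R] {n : ℕ}

variable (R) in
/-- `extStrip` on the left factor of the enveloping algebra. -/
noncomputable def envStrip (j : Fin n) : Env R (ExtAlg R n) →ₗ[R] Env R (ExtAlg R n) :=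
  (extStrip R j).rTensor _

theorem envStrip_tmul (j : Fin n) (a : ExtAlg R n) (b : (ExtAlg R n)ᵐᵒᵖ) :
    envStrip R j (a ⊗ₜ b) = extStrip R j a ⊗ₜ b := rfl

theorem envStrip_mul_of_lt {i m : Fin n} (h : i < m) (e : Env R (ExtAlg R n)) :
    envStrip R m (e * extX R n i ⊗ₜ 1) = -(envStrip R m e * extX R n i ⊗ₜ 1) := by
  induction e using TensorProduct.induction_on with
  | zero => simp
  | add _ _ h₁ h₂ => simp only [add_mul, map_add, h₁, h₂, neg_add]
  | tmul x y => simp [envStrip_tmul, extStrip_mul_of_lt h, TensorProduct.neg_tmul]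

theorem envStrip_mul_of_gt {i m : Fin n} (h : m < i) (e : Env R (ExtAlg R n)) :
    envStrip R m (e * extX R n i ⊗ₜ 1) = 0 := by
  induction e using TensorProduct.induction_on with
  | zero => simp
  | add _ _ h₁ h₂ => simp only [add_mul, map_add, h₁, h₂, add_zero]
  | tmul x y => simp [envStrip_tmul, extStrip_mul_of_gt h]

theorem sum_envStrip_mul (e : Env R (ExtAlg R n)) :
    ∑ i, envStrip R i e * extX R n i ⊗ₜ 1 = e - (extConst R).rTensor _ e := by
  induction e using TensorProduct.induction_on with
  | zero => simp
  | add _ _ h₁ h₂ => simp only [add_mul, map_add, Finset.sum_add_distrib, h₁, h₂]; abel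
  | tmul x y => simp [envStrip_tmul, ← TensorProduct.sum_tmul, sum_extStrip_mul,
      TensorProduct.sub_tmul]

theorem sum_envStrip_mul_add (m : Fin n) (e : Env R (ExtAlg R n)) :
    ∑ i ∈ Finset.univ.filter (m ≤ ·), envStrip R i e * extX R n i ⊗ₜ 1 +
      envStrip R m (e * extX R n m ⊗ₜ 1) = e := by
  induction e using TensorProduct.induction_on with
  | zero => simp
  | add x y h₁ h₂ =>
    conv_rhs => rw [← h₁, ← h₂]
    simp only [add_mul, map_add, Finset.sum_add_distrib]
    abel
  | tmul x y =>
    simp only [envStrip_tmul, Algebra.TensorProduct.tmul_mul_tmul, mul_one,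
      ← TensorProduct.sum_tmul, ← TensorProduct.add_tmul, sum_extStrip_mul_add]

theorem envStrip_mem {p : ℕ} (j : Fin n) {e : Env R (ExtAlg R n)} (he : e ∈ envFil R n 0 p) :
    envStrip R j e ∈ envFil R n 0 p := by
  have : envFil R n 0 p ≤ (envFil R n 0 p).comap (envStrip R j) := by
    conv_lhs => rw [envFil]
    rw [Submodule.span_le]
    rintro _ ⟨σ, ρ, h, rfl⟩
    simp only [SetLike.mem_coe, Submodule.mem_comap, envStrip_tmul]
    by_cases hj : IsGreatest (σ : Set (Fin n)) j
    · rw [extStrip_of_isGreatest hj]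
      exact tmul_mem_envFil (by simpa using h)
    · rw [extStrip_of_not_isGreatest hj]
      simp
  exact this he

/-- On the kernel of the multiplication `Aᵉ → A`, the part that is constant in the left factor
has larger degree in the right factor. -/
theorem const_mem_of_aug_eq_zero {p : ℕ} {e : Env R (ExtAlg R n)} (he : e ∈ envFil R n 0 p)
    (h0 : e • RegBimod.of R (1 : ExtAlg R n) = 0) :
    (extConst R).rTensor _ e ∈ envFil R n 0 (p + 1) := by
  -- `b ↦ 1 ⊗ b` turns the multiplication map into an endomorphism of `Aᵉ`.
  let φ : Env R (ExtAlg R n) →ₗ[R] Env R (ExtAlg R n) :=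
    TensorProduct.lift (LinearMap.mk₂ R
      (fun (x : ExtAlg R n) (y : (ExtAlg R n)ᵐᵒᵖ) => (1 : ExtAlg R n) ⊗ₜ[R]
        MulOpposite.op (x * y.unop))
      (by intros; simp [add_mul, TensorProduct.tmul_add])
      (by intros; simp [TensorProduct.tmul_smul])
      (by intros; simp [mul_add, TensorProduct.tmul_add])
      (by intros; simp [TensorProduct.tmul_smul]))
  let ψ : RegBimod R (ExtAlg R n) →ₗ[R] Env R (ExtAlg R n) :=
    { toFun := fun a => (1 : ExtAlg R n) ⊗ₜ[R] MulOpposite.op (show ExtAlg R n from a)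
      map_add' := fun a b => TensorProduct.tmul_add (1 : ExtAlg R n)
        (MulOpposite.op (show ExtAlg R n from a)) (.op (show ExtAlg R n from b))
      map_smul' := fun c a => TensorProduct.tmul_smul c (1 : ExtAlg R n)
        (MulOpposite.op (show ExtAlg R n from a)) }
  have hφ : φ = ψ ∘ₗ (LinearMap.toSpanSingleton (Env R (ExtAlg R n)) _
      (RegBimod.of R (1 : ExtAlg R n))).restrictScalars R := by
    refine TensorProduct.ext' fun x y => ?_
    obtain ⟨y, rfl⟩ := MulOpposite.op_surjective y
    rw [LinearMap.comp_apply, LinearMap.restrictScalars_apply, LinearMap.toSpanSingleton_apply,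
      env_smul_of, mul_one]
    rfl
  have hle : envFil R n 0 p ≤
      (envFil R n 0 (p + 1)).comap ((extConst R).rTensor _ - φ) := by
    conv_lhs => rw [envFil]
    rw [Submodule.span_le]
    rintro _ ⟨σ, ρ, h, rfl⟩
    have h1 : φ (extBasis R n σ ⊗ₜ[R] MulOpposite.op (extBasis R n ρ)) =
        1 ⊗ₜ[R] MulOpposite.op (extBasis R n σ * extBasis R n ρ) := by simp [φ]
    rw [SetLike.mem_coe, Submodule.mem_comap, LinearMap.sub_apply, h1, LinearMap.rTensor_tmul,
      extConst, Module.Basis.constr_basis]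
    split_ifs with hσ
    · simp [hσ]
    · obtain h2 | ⟨s, hs, h2⟩ := extBasis_mul_cases (R := R) σ ρ
      · simp [h2]
      · have : extBasis R n ∅ ⊗ₜ[R] MulOpposite.op (extBasis R n (σ ∪ ρ)) ∈
            envFil R n 0 (p + 1) := by
          refine tmul_mem_envFil ?_
          have := Finset.card_pos.2 (Finset.nonempty_iff_ne_empty.2 hσ)
          omega
        rw [extBasis_empty] at this
        rw [h2]
        rcases Int.units_eq_one_or s with rfl | rfl <;> simpa [TensorProduct.tmul_neg]
  have := hle he
  rwa [Submodule.mem_comap, LinearMap.sub_apply, hφ, LinearMap.comp_apply,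
    LinearMap.restrictScalars_apply, LinearMap.toSpanSingleton_apply, h0, map_zero,
    sub_zero] at this

end EnvContraction

/-! ### The resolution by divided powers: exactness and minimality -/

section Resolution

variable {R : Type*} [CommRing R] {n : ℕ}

/-- The differential in coordinates. -/
theorem mresD_apply (k : ℕ) (f : MRes R n (k + 1)) (τ' : Sym (Fin n) k) :
    mresD R n k f τ' = ∑ i, f (i ::ₛ τ') * mresCoeff R n (k + 1) i := by
  classical
  induction f using Finsupp.induction_linear with
  | zero => simp
  | add f g hf hg => simp only [map_add, Finsupp.add_apply, hf, hg, add_mul, Finset.sum_add_distrib]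
  | single τ a =>
    have h1 (i : {i // i ∈ (τ : Multiset (Fin n)).toFinset}) :
        (Finsupp.single (τ.erase i.1 (Multiset.mem_toFinset.1 i.2)) (mresCoeff R n (k + 1) i.1) :
          MRes R n k) τ' = if τ = i.1 ::ₛ τ' then mresCoeff R n (k + 1) i.1 else 0 := by
      rw [Finsupp.single_apply]
      refine if_congr ⟨fun h => ?_, fun h => ?_⟩ rfl rfl
      · rw [← h, Sym.cons_erase]
      · obtain ⟨i, hi⟩ := i
        have h' : τ = i ::ₛ τ' := h
        subst h'
        exact Sym.erase_cons_head _ _ _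
    rw [mresD, Finsupp.linearCombination_single, Finsupp.smul_apply, Finsupp.finsetSum_apply,
      smul_eq_mul, Finset.sum_congr rfl fun i _ => h1 i,
      Finset.sum_coe_sort (τ : Multiset (Fin n)).toFinset
        (fun i => if τ = i ::ₛ τ' then mresCoeff R n (k + 1) i else 0), Finset.mul_sum]
    refine (Finset.sum_subset (Finset.subset_univ _) fun i _ hi => ?_).trans
      (Finset.sum_congr rfl fun i _ => ?_)
    · rw [if_neg, mul_zero]
      rintro rfl
      exact hi (by simp)
    · rw [Finsupp.single_apply]
      split_ifs <;> simp

theorem mresAug_apply (f : MRes R n 0) (τ : Sym (Fin n) 0) :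
    mresAug R n f = f τ • RegBimod.of R (1 : ExtAlg R n) := by
  rw [mresAug, Finsupp.linearCombination_apply,
    Finsupp.sum_fintype f (fun _ e => e • RegBimod.of R (1 : ExtAlg R n)) fun _ =>
      zero_smul (Env R (ExtAlg R n)) (RegBimod.of R (1 : ExtAlg R n)),
    Fintype.sum_eq_single τ fun x hx => absurd (Subsingleton.elim _ _) hx]

theorem add_smul_mul_swap {S : Type*} [Ring S] [Algebra R S] {p p' q q' : S} (c : R)
    (h : p * q = -(q * p)) (h' : p' * q' = -(q' * p')) (h₁ : p * q' = q' * p)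
    (h₂ : p' * q = q * p') :
    (p + c • p') * (q + (-c) • q') = -((q + c • q') * (p + (-c) • p')) := by
  simp only [mul_add, add_mul, mul_smul_comm, smul_mul_assoc, h, h', h₁, h₂]
  module

theorem add_smul_mul_self {S : Type*} [Ring S] [Algebra R S] {p p' : S} (c : R)
    (h : p * p = 0) (h' : p' * p' = 0) (h₁ : p * p' = p' * p) :
    (p + c • p') * (p + (-c) • p') = 0 := by
  simp only [mul_add, add_mul, mul_smul_comm, smul_mul_assoc, h, h', h₁]
  module

/-- The coefficients of consecutive differentials anticommute, because their signs differ. -/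
theorem mresCoeff_mul_swap (k : ℕ) (i j : Fin n) :
    mresCoeff R n (k + 1) i * mresCoeff R n k j =
      -(mresCoeff R n (k + 1) j * mresCoeff R n k i) := by
  have hk : (-1 : R) ^ k = -(-1) ^ (k + 1) := by rw [pow_succ]; simp
  rw [mresCoeff, mresCoeff, mresCoeff, mresCoeff, hk]
  refine add_smul_mul_swap _ ?_ ?_ ?_ ?_
  · rw [Algebra.TensorProduct.tmul_mul_tmul, Algebra.TensorProduct.tmul_mul_tmul, extX_anticomm]
    exact TensorProduct.neg_tmul _ _
  · rw [Algebra.TensorProduct.tmul_mul_tmul, Algebra.TensorProduct.tmul_mul_tmul,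
      ← MulOpposite.op_mul, ← MulOpposite.op_mul, extX_anticomm]
    exact TensorProduct.tmul_neg _ _
  all_goals simp

theorem mresCoeff_mul_self (k : ℕ) (i : Fin n) :
    mresCoeff R n (k + 1) i * mresCoeff R n k i = 0 := by
  have hk : (-1 : R) ^ k = -(-1) ^ (k + 1) := by rw [pow_succ]; simp
  rw [mresCoeff, mresCoeff, hk]
  refine add_smul_mul_self _ ?_ ?_ ?_
  · simp [extX_sq]
  · simp [← MulOpposite.op_mul, extX_sq]
  · simp

theorem Finset.sum_sum_eq_zero_of_antisymm {ι M : Type*} [Fintype ι] [AddCommGroup M]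
    (g : ι → ι → M) (h0 : ∀ i, g i i = 0) (h : ∀ i j, g i j = -g j i) :
    ∑ i, ∑ j, g i j = 0 := by
  classical
  rw [← Fintype.sum_prod_type' g]
  refine Finset.sum_involution (fun p _ => p.swap) ?_ ?_ ?_ ?_
  · rintro ⟨i, j⟩ _
    simp [h i j]
  · rintro ⟨i, j⟩ _ hne heq
    obtain rfl : j = i := congrArg Prod.fst heq
    exact hne (h0 j)
  · simp
  · simp

theorem mresD_mresD (k : ℕ) (f : MRes R n (k + 2)) : mresD R n k (mresD R n (k + 1) f) = 0 := by
  ext τ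
  simp only [mresD_apply, Finset.sum_mul, Finsupp.zero_apply, mul_assoc]
  refine Finset.sum_sum_eq_zero_of_antisymm _ (fun i => ?_) fun i j => ?_
  · rw [mresCoeff_mul_self, mul_zero]
  · rw [Sym.cons_swap, mresCoeff_mul_swap]
    exact mul_neg (f (i ::ₛ j ::ₛ τ)) (mresCoeff R n (k + 2) i * mresCoeff R n (k + 1) j)

theorem mresAug_mresD (f : MRes R n 1) : mresAug R n (mresD R n 0 f) = 0 := by
  rw [mresAug_apply _ Sym.nil, mresD_apply, Finset.sum_smul]
  refine Finset.sum_eq_zero fun i _ => ?_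
  rw [mul_smul]
  have : mresCoeff R n (0 + 1) i • RegBimod.of R (1 : ExtAlg R n) = 0 := by
    rw [mresCoeff, add_smul, zero_add, pow_one, smul_assoc, ← MulOpposite.op_one, env_smul_of,
      env_smul_of]
    simp only [mul_one, one_mul, neg_one_smul]
    exact add_neg_cancel _
  rw [this, smul_zero]

theorem Sym.exists_max_cons {k : ℕ} (τ : Sym (Fin n) (k + 1)) :
    ∃ (m : Fin n) (τ₀ : Sym (Fin n) k), τ = m ::ₛ τ₀ ∧ ∀ a ∈ τ₀, a ≤ m := by
  have hne : (τ : Multiset (Fin n)).toFinset.Nonempty := by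
    obtain ⟨a, ha⟩ := τ.exists_mem
    exact ⟨a, by simpa using ha⟩
  have hm := Finset.isGreatest_max' _ hne
  refine ⟨_, τ.erase _ (Multiset.mem_toFinset.1 hm.1), (Sym.cons_erase _).symm, fun a ha => ?_⟩
  refine hm.2 ?_
  simpa using Multiset.mem_of_mem_erase ha

/-- The maximum of a nonempty multisubset of `[n]`. -/
noncomputable def symMax {k : ℕ} (τ : Sym (Fin n) (k + 1)) : Fin n :=
  (Sym.exists_max_cons τ).choose

theorem symMax_cons {k : ℕ} {m : Fin n} {τ : Sym (Fin n) k} (h : ∀ a ∈ τ, a ≤ m) :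
    symMax (m ::ₛ τ) = m := by
  obtain ⟨τ₀, h1, h2⟩ := (Sym.exists_max_cons (m ::ₛ τ)).choose_spec
  change m ::ₛ τ = symMax (m ::ₛ τ) ::ₛ τ₀ at h1
  change ∀ a ∈ τ₀, a ≤ symMax (m ::ₛ τ) at h2
  generalize symMax (m ::ₛ τ) = x at h1 h2 ⊢
  have h3 : x ∈ m ::ₛ τ := by rw [h1]; exact Sym.mem_cons_self _ _
  have h4 : m ∈ x ::ₛ τ₀ := by rw [← h1]; exact Sym.mem_cons_self _ _
  refine le_antisymm ?_ ?_
  · rcases Sym.mem_cons.1 h3 with h3 | h3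
    exacts [h3.le, h _ h3]
  · rcases Sym.mem_cons.1 h4 with h4 | h4
    exacts [h4.le, h2 _ h4]

theorem symMax_mem {k : ℕ} (τ : Sym (Fin n) (k + 1)) : symMax τ ∈ τ := by
  obtain ⟨m, τ, rfl, h⟩ := Sym.exists_max_cons τ
  rw [symMax_cons h]
  exact Sym.mem_cons_self _ _

/-- The contraction of the left Koszul complex, extended linearly in the right factor: it sends
`(x_σ ⊗ b) x_(τ)` with `j = max σ ≥ max τ` to `(x_{σ ∖ j} ⊗ b) x_(τ ∪ j)` and kills the remaining
monomials. -/
noncomputable def mresHtpy {k : ℕ} (f : MRes R n k) : MRes R n (k + 1) :=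
  Finsupp.equivFunOnFinite.symm fun τ =>
    envStrip R (symMax τ) (f (τ.erase (symMax τ) (symMax_mem τ)))

theorem mresHtpy_cons {k : ℕ} (f : MRes R n k) {m : Fin n} {τ : Sym (Fin n) k}
    (h : ∀ a ∈ τ, a ≤ m) : mresHtpy f (m ::ₛ τ) = envStrip R m (f τ) := by
  have : ∀ (a : Fin n) (ha : a ∈ m ::ₛ τ), a = m →
      envStrip R a (f ((m ::ₛ τ).erase a ha)) = envStrip R m (f τ) := by
    rintro a ha rfl
    rw [Sym.erase_cons_head]
  exact this _ _ (symMax_cons h)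

theorem mresHtpy_mem {k p : ℕ} {f : MRes R n k} (h : ∀ τ, f τ ∈ envFil R n 0 p)
    (τ : Sym (Fin n) (k + 1)) : mresHtpy f τ ∈ envFil R n 0 p :=
  envStrip_mem _ (h _)

theorem sum_mresHtpy_mul_nil (f : MRes R n 0) (τ : Sym (Fin n) 0) :
    ∑ i, mresHtpy f (i ::ₛ τ) * extX R n i ⊗ₜ 1 = f τ - (extConst R).rTensor _ (f τ) := by
  have h (i : Fin n) : mresHtpy f (i ::ₛ τ) = envStrip R i (f τ) :=
    mresHtpy_cons f fun a ha => by
      rw [Sym.eq_nil_of_card_zero τ] at ha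
      exact absurd ha (Sym.notMem_nil a)
  simp only [h, sum_envStrip_mul]

/-- `d h + h d = 1` in positive degrees, for the left part `d` of the differential. -/
theorem sum_mresHtpy_mul_add {k : ℕ} (f : MRes R n (k + 1)) {m : Fin n} {τ : Sym (Fin n) k}
    (hm : ∀ a ∈ τ, a ≤ m) :
    ∑ i, mresHtpy f (i ::ₛ m ::ₛ τ) * extX R n i ⊗ₜ 1 +
      envStrip R m (∑ i, f (i ::ₛ τ) * extX R n i ⊗ₜ 1) = f (m ::ₛ τ) := by
  have h1 (i : Fin n) : mresHtpy f (i ::ₛ m ::ₛ τ) =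
      if m ≤ i then envStrip R i (f (m ::ₛ τ)) else envStrip R m (f (i ::ₛ τ)) := by
    split_ifs with hi
    · refine mresHtpy_cons f fun a ha => ?_
      rcases Sym.mem_cons.1 ha with rfl | ha
      exacts [hi, (hm a ha).trans hi]
    · rw [Sym.cons_swap]
      refine mresHtpy_cons f fun a ha => ?_
      rcases Sym.mem_cons.1 ha with rfl | ha
      exacts [(not_le.1 hi).le, hm a ha]
  have h2 (i : Fin n) : envStrip R m (f (i ::ₛ τ) * extX R n i ⊗ₜ 1) =
      (if i = m then envStrip R m (f (m ::ₛ τ) * extX R n m ⊗ₜ 1) else 0) -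
      if m ≤ i then 0 else envStrip R m (f (i ::ₛ τ)) * extX R n i ⊗ₜ 1 := by
    rcases lt_trichotomy i m with h | rfl | h
    · rw [if_neg h.ne, if_neg h.not_ge, envStrip_mul_of_lt h, zero_sub]
    · simp
    · rw [if_neg h.ne', if_pos h.le, envStrip_mul_of_gt h, sub_zero]
  rw [map_sum, Finset.sum_congr rfl fun i _ => h2 i, Finset.sum_sub_distrib, Finset.sum_ite_eq',
    if_pos (Finset.mem_univ m)]
  conv_rhs => rw [← sum_envStrip_mul_add m (f (m ::ₛ τ))]
  simp only [h1, Finset.sum_filter, ite_mul]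
  rw [add_sub_left_comm, ← Finset.sum_sub_distrib, add_comm]
  congr 1
  refine Finset.sum_congr rfl fun i _ => ?_
  split_ifs <;> simp

theorem sum_mul_mresCoeff {k l : ℕ} (f : MRes R n (k + 1)) (τ : Sym (Fin n) k) :
    ∑ i, f (i ::ₛ τ) * mresCoeff R n l i = ∑ i, f (i ::ₛ τ) * extX R n i ⊗ₜ 1 +
      (-1 : R) ^ l • ∑ i, f (i ::ₛ τ) * 1 ⊗ₜ MulOpposite.op (extX R n i) := by
  simp only [mresCoeff, mul_add, Finset.sum_add_distrib, mul_smul_comm, Finset.smul_sum]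

theorem sum_mul_op_mem {k p : ℕ} {f : MRes R n (k + 1)} (h : ∀ τ, f τ ∈ envFil R n 0 p)
    (τ : Sym (Fin n) k) :
    ∑ i, f (i ::ₛ τ) * 1 ⊗ₜ MulOpposite.op (extX R n i) ∈ envFil R n 0 (p + 1) :=
  sum_mem fun i _ => mul_mem_envFil (h _) (one_tmul_extX_mem 0 i)

/-- Subtracting the boundary of its contraction raises the degree of a cycle in the right factor:
the left part of the differential cancels, and the right part multiplies by generators. -/
theorem sub_mresD_mresHtpy_mem {k p : ℕ} {f : MRes R n (k + 1)} (h : ∀ τ, f τ ∈ envFil R n 0 p)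
    (hf : mresD R n k f = 0) (τ : Sym (Fin n) (k + 1)) :
    (f - mresD R n (k + 1) (mresHtpy f)) τ ∈ envFil R n 0 (p + 1) := by
  obtain ⟨m, τ, rfl, hm⟩ := Sym.exists_max_cons τ
  have h0 : mresD R n k f τ = 0 := by rw [hf]; rfl
  rw [mresD_apply, sum_mul_mresCoeff] at h0
  have h1 := sum_mresHtpy_mul_add f hm
  rw [eq_neg_of_add_eq_zero_left h0] at h1
  rw [Finsupp.sub_apply, mresD_apply, sum_mul_mresCoeff, ← h1, add_sub_add_left_eq_sub]
  refine sub_mem (envStrip_mem _ (neg_mem ?_)) ?_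
  · exact Submodule.smul_mem _ _ (sum_mul_op_mem h τ)
  · exact Submodule.smul_mem _ _ (sum_mul_op_mem (mresHtpy_mem h) _)

theorem sub_mresD_mresHtpy_mem_zero {p : ℕ} {f : MRes R n 0} (h : ∀ τ, f τ ∈ envFil R n 0 p)
    (hf : mresAug R n f = 0) (τ : Sym (Fin n) 0) :
    (f - mresD R n 0 (mresHtpy f)) τ ∈ envFil R n 0 (p + 1) := by
  rw [mresAug_apply f τ] at hf
  rw [Finsupp.sub_apply, mresD_apply, sum_mul_mresCoeff, sum_mresHtpy_mul_nil, sub_add,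
    sub_sub_cancel]
  refine sub_mem (const_mem_of_aug_eq_zero (h τ) hf) ?_
  exact Submodule.smul_mem _ _ (sum_mul_op_mem (mresHtpy_mem h) _)

/-- A difference is a linear combination over `Aᵉ`, so that submodules are closed under it. -/
theorem mres_sub_eq {k : ℕ} (f g : MRes R n k) : f - g = f + (-1 : Env R (ExtAlg R n)) • g := by
  ext τ
  exact (sub_eq_add_neg (f τ) (g τ)).trans (congrArg (f τ + ·) (neg_one_mul (g τ)).symm)

/-- Successive approximation: if every cycle of filtration degree `p` is homologous to one of
degree `p + 1`, every cycle is a boundary, as the filtration is finite. -/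
theorem le_range_of_approx {k : ℕ} (Z : Submodule (Env R (ExtAlg R n)) (MRes R n k))
    (hZ : ∀ g, mresD R n k g ∈ Z)
    (H : ∀ (p : ℕ) (f : MRes R n k), (∀ τ, f τ ∈ envFil R n 0 p) → f ∈ Z →
      ∀ τ, (f - mresD R n k (mresHtpy f)) τ ∈ envFil R n 0 (p + 1)) :
    Z ≤ LinearMap.range (mresD R n k) := by
  suffices ∀ q p : ℕ, n < p + q → ∀ f : MRes R n k, (∀ τ, f τ ∈ envFil R n 0 p) → f ∈ Z →
      f ∈ LinearMap.range (mresD R n k) from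
    fun f hf => this (n + 1) 0 (by omega) f (fun τ => mem_envFil_zero _ _) hf
  intro q
  induction q with
  | zero =>
    intro p hp f h _
    have : f = 0 := by
      ext τ
      have := h τ
      rwa [envFil_eq_bot (by omega), Submodule.mem_bot] at this
    rw [this]
    exact zero_mem _
  | succ q ih =>
    intro p hp f h hf
    have h1 := ih (p + 1) (by omega) _ (H p f h hf) (by
      rw [mres_sub_eq]
      exact add_mem hf (Z.smul_mem _ (hZ _)))
    have h2 := add_mem h1 (LinearMap.mem_range_self (mresD R n k) (mresHtpy f))
    have h3 : f - mresD R n k (mresHtpy f) + mresD R n k (mresHtpy f) = f := by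
      ext τ
      exact sub_add_cancel (f τ) (mresD R n k (mresHtpy f) τ)
    rwa [h3] at h2

variable (R n) in
theorem isFreeResolution_mres : IsFreeResolution (X := MRes R n) (mresD R n) (mresAug R n) := by
  refine ⟨fun k => inferInstance, fun a => ?_, fun f => ⟨fun hf => ?_, ?_⟩,
    fun k f => ⟨fun hf => ?_, ?_⟩⟩
  · refine ⟨Finsupp.single Sym.nil ((show ExtAlg R n from a) ⊗ₜ MulOpposite.op 1), ?_⟩
    rw [mresAug_apply _ Sym.nil, Finsupp.single_eq_same, env_smul_of, mul_one, mul_one]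
    rfl
  · exact le_range_of_approx (LinearMap.ker (mresAug R n)) mresAug_mresD
      (fun p f h hf => sub_mresD_mresHtpy_mem_zero h hf) hf
  · rintro ⟨g, rfl⟩
    exact mresAug_mresD g
  · exact le_range_of_approx (LinearMap.ker (mresD R n k)) (mresD_mresD k)
      (fun p f h hf => sub_mresD_mresHtpy_mem h hf) hf
  · rintro ⟨g, rfl⟩
    exact mresD_mresD k g

/-- A form of Nakayama's lemma: the differential raises the total degree, which is bounded. -/
theorem isMinimalComplex_mres : IsMinimalComplex (X := MRes R n) (mresD R n) := by
  classical
  intro k P hP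
  have key : ∀ q p : ℕ, 2 * n < p + q → ∀ f : MRes R n k, (∀ τ, f τ ∈ envFil R n 1 p) → f ∈ P := by
    intro q
    induction q with
    | zero =>
      intro p hp f h
      have : f = 0 := by
        ext τ
        have := h τ
        rwa [envFil_eq_bot (by omega), Submodule.mem_bot] at this
      rw [this]
      exact zero_mem _
    | succ q ih =>
      intro p hp f h
      rw [← Finsupp.sum_single f, Finsupp.sum]
      refine sum_mem fun τ _ => ?_
      have h1 : (Finsupp.single τ 1 : MRes R n k) ∈ P ⊔ LinearMap.range (mresD R n k) := by
        rw [hP]; trivial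
      obtain ⟨x, hx, _, ⟨y, rfl⟩, hxy⟩ := Submodule.mem_sup.1 h1
      rw [← mul_one (f τ), ← smul_eq_mul, ← Finsupp.smul_single, ← hxy, smul_add]
      refine add_mem (P.smul_mem _ hx) (ih (p + 1) (by omega) _ fun τ' => ?_)
      rw [Finsupp.smul_apply, mresD_apply, smul_eq_mul, Finset.mul_sum]
      refine sum_mem fun i _ => ?_
      rw [← mul_assoc]
      refine mul_mem_envFil ?_ (mresCoeff_mem _ i)
      simpa using mul_mem_envFil (h τ) (mem_envFil_zero 1 (y (i ::ₛ τ')))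
  rw [eq_top_iff]
  exact fun f _ => key (2 * n + 1) 0 (by omega) f fun τ => mem_envFil_zero _ _

/-- The matrix entries have positive total degree and are therefore nilpotent. -/
theorem not_isUnit_mresD [Nontrivial R] (k : ℕ) (τ : Sym (Fin n) (k + 1)) (τ' : Sym (Fin n) k) :
    ¬ IsUnit (mresD R n k (Finsupp.single τ 1) τ') := by
  have : Nontrivial (Env R (ExtAlg R n)) := by
    have := (envBasis R n).ne_zero (∅, ∅)
    exact nontrivial_of_ne _ _ this
  have hmem : mresD R n k (Finsupp.single τ 1) τ' ∈ envFil R n 1 1 := by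
    rw [mresD_apply]
    refine sum_mem fun i _ => ?_
    simpa using mul_mem_envFil (mem_envFil_zero 1 _) (mresCoeff_mem (R := R) (k + 1) i)
  have hpow (p : ℕ) : (mresD R n k (Finsupp.single τ 1) τ') ^ p ∈ envFil R n 1 p := by
    induction p with
    | zero => exact mem_envFil_zero _ _
    | succ p ih => rw [pow_succ]; exact mul_mem_envFil ih hmem
  refine IsNilpotent.not_isUnit ⟨2 * n + 1, ?_⟩
  have := hpow (2 * n + 1)
  rwa [envFil_eq_bot (by omega), Submodule.mem_bot] at this

end Resolution

/-! ### The comparison theorem for free resolutions -/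

section Comparison

/-- Dependent choice for a sequence whose terms have varying types. -/
theorem exists_dependent_seq {α : ℕ → Type*} {P : ∀ k, α k → Prop}
    {Q : ∀ k, α k → α (k + 1) → Prop} (a : α 0) (ha : P 0 a)
    (h : ∀ k x, P k x → ∃ y, Q k x y ∧ P (k + 1) y) :
    ∃ f : ∀ k, α k, f 0 = a ∧ ∀ k, Q k (f k) (f (k + 1)) := by
  choose g hQ hP using h
  let F : ∀ k, {x : α k // P k x} :=
    fun k => Nat.rec ⟨a, ha⟩ (fun k x => ⟨g k x.1 x.2, hP k x.1 x.2⟩) k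
  exact ⟨fun k => (F k).1, rfl, fun k => hQ k (F k).1 (F k).2⟩

variable {S : Type*} [Ring S] {N : Type*} [AddCommGroup N] [Module S N]
  {X Y : ℕ → Type*} [∀ k, AddCommGroup (X k)] [∀ k, Module S (X k)]
  [∀ k, AddCommGroup (Y k)] [∀ k, Module S (Y k)]
  {dX : ∀ k, X (k + 1) →ₗ[S] X k} {εX : X 0 →ₗ[S] N}
  {dY : ∀ k, Y (k + 1) →ₗ[S] Y k} {εY : Y 0 →ₗ[S] N}

theorem exists_lift_of_range_le {P A B : Type*} [AddCommGroup P] [Module S P] [Module.Free S P]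
    [AddCommGroup A] [Module S A] [AddCommGroup B] [Module S B] (d : A →ₗ[S] B) (φ : P →ₗ[S] B)
    (h : ∀ x, φ x ∈ LinearMap.range d) : ∃ ψ : P →ₗ[S] A, φ = d ∘ₗ ψ := by
  obtain ⟨ψ, hψ⟩ := Module.projective_lifting_property d.rangeRestrict
    (φ.codRestrict _ h) d.surjective_rangeRestrict
  refine ⟨ψ, LinearMap.ext fun x => ?_⟩
  exact (congrArg Subtype.val (LinearMap.congr_fun hψ x)).symm

theorem IsFreeResolution.exists_chainMap (hX : IsFreeResolution dX εX)
    (hY : IsFreeResolution dY εY) : ∃ f : ∀ k, X k →ₗ[S] Y k, IsChainMapOver dX εX dY εY f := by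
  have := hX.1
  obtain ⟨f₀, h₀⟩ := exists_lift_of_range_le εY εX fun x =>
    LinearMap.range_eq_top.2 hY.2.1 ▸ Submodule.mem_top
  obtain ⟨f, hf0, hf⟩ := exists_dependent_seq (α := fun k => X k →ₗ[S] Y k)
    (P := fun k f => ∀ x, f (dX k x) ∈ LinearMap.range (dY k))
    (Q := fun k f g => f ∘ₗ dX k = dY k ∘ₗ g) f₀
    (fun x => (hY.2.2.1 _).1 (by
      rw [← LinearMap.comp_apply, ← h₀]
      exact (hX.2.2.1 _).2 ⟨x, rfl⟩))
    (fun k f hf => by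
      obtain ⟨g, hg⟩ := exists_lift_of_range_le (dY k) (f ∘ₗ dX k) hf
      refine ⟨g, hg, fun x => (hY.2.2.2 k _).1 ?_⟩
      rw [← LinearMap.comp_apply, ← hg, LinearMap.comp_apply, (hX.2.2.2 k _).2 ⟨x, rfl⟩,
        map_zero])
  exact ⟨f, by rw [hf0, ← h₀], hf⟩

theorem IsFreeResolution.exists_homotopy (hX : IsFreeResolution dX εX)
    {φ : ∀ k, X k →ₗ[S] X k} (hφ : IsChainMapOver dX εX dX εX φ) :
    ∃ s : ∀ k, X k →ₗ[S] X (k + 1), IsHomotopyToId dX φ s := by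
  have := hX.1
  have hdd (k : ℕ) (x) : dX k (dX (k + 1) x) = 0 := (hX.2.2.2 k _).2 ⟨x, rfl⟩
  have hφ' (k : ℕ) (x) : φ k (dX k x) = dX k (φ (k + 1) x) := LinearMap.congr_fun (hφ.2 k) x
  obtain ⟨s₀, h₀⟩ := exists_lift_of_range_le (dX 0) (φ 0 - LinearMap.id) fun x =>
    (hX.2.2.1 _).1 (by
      have : εX (φ 0 x) = εX x := LinearMap.congr_fun hφ.1 x
      simp [this])
  obtain ⟨s, hs0, hs⟩ := exists_dependent_seq (α := fun k => X k →ₗ[S] X (k + 1))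
    (P := fun k s => ∀ x, φ k (dX k x) - dX k x = dX k (s (dX k x)))
    (Q := fun k s t => φ (k + 1) - LinearMap.id = dX (k + 1) ∘ₗ t + s ∘ₗ dX k) s₀
    (fun x => LinearMap.congr_fun h₀ (dX 0 x))
    (fun k s hs => by
      obtain ⟨t, ht⟩ := exists_lift_of_range_le (dX (k + 1))
        (φ (k + 1) - LinearMap.id - s ∘ₗ dX k) fun x => (hX.2.2.2 k _).1 (by
          simp [← hφ', ← hs x])
      refine ⟨t, by rw [← ht, sub_add_cancel], fun x => ?_⟩
      have := LinearMap.congr_fun ht (dX (k + 1) x)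
      simpa [hdd] using this)
  exact ⟨s, by rw [h₀, hs0], hs⟩

theorem IsChainMapOver.comp {Z : ℕ → Type*} [∀ k, AddCommGroup (Z k)] [∀ k, Module S (Z k)]
    {dZ : ∀ k, Z (k + 1) →ₗ[S] Z k} {εZ : Z 0 →ₗ[S] N}
    {f : ∀ k, X k →ₗ[S] Y k} {g : ∀ k, Y k →ₗ[S] Z k}
    (hg : IsChainMapOver dY εY dZ εZ g) (hf : IsChainMapOver dX εX dY εY f) :
    IsChainMapOver dX εX dZ εZ fun k => g k ∘ₗ f k :=
  ⟨by rw [← LinearMap.comp_assoc, hg.1, hf.1], fun k => by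
    rw [LinearMap.comp_assoc, hf.2, ← LinearMap.comp_assoc, hg.2, LinearMap.comp_assoc]⟩

/-- Two free resolutions of the same module are homotopy equivalent over it. -/
theorem IsFreeResolution.areHomotopyEquivalentOver (hX : IsFreeResolution dX εX)
    (hY : IsFreeResolution dY εY) : AreHomotopyEquivalentOver dX εX dY εY := by
  obtain ⟨f, hf⟩ := hX.exists_chainMap hY
  obtain ⟨g, hg⟩ := hY.exists_chainMap hX
  obtain ⟨s, hs⟩ := hX.exists_homotopy (hg.comp hf)
  obtain ⟨t, ht⟩ := hY.exists_homotopy (hf.comp hg)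
  exact ⟨f, g, s, t, hf, hg, hs, ht⟩

end Comparison

/-! ### Exactness of the bar resolution -/

section BarExact

variable (R A : Type*) [CommRing R] [Ring A] [Algebra R A]

/-- The contracting homotopy `a₀ ⊗ ⋯ ⊗ aₖ₊₁ ↦ 1 ⊗ a₀ ⊗ ⋯ ⊗ aₖ₊₁` of the bar resolution. -/
noncomputable def barHtpy (k : ℕ) : Bar R A k →ₗ[R] Bar R A (k + 1) :=
  let φ (α : A) : (⨂[R] _ : Fin k, A) →ₗ[R] ⨂[R] _ : Fin (k + 1), A :=
    PiTensorProduct.lift ((PiTensorProduct.tprod R (s := fun _ : Fin (k + 1) => A)).curryLeft α)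
  TensorProduct.lift (TensorProduct.lift (LinearMap.mk₂ R
    (fun (α : A) (β : Aᵐᵒᵖ) =>
      (TensorProduct.mk R (Env R A) (⨂[R] _ : Fin (k + 1), A) (1 ⊗ₜ β)) ∘ₗ φ α)
    (by intros; ext; simp [φ, TensorProduct.tmul_add])
    (by intros; ext; simp [φ])
    (by intros; ext; simp [φ, TensorProduct.tmul_add])
    (by intros; ext; simp [φ, TensorProduct.smul_tmul'])))

theorem barHtpy_tensor (k : ℕ) (a : Fin (k + 2) → A) :
    barHtpy R A k (barTensor R A k a) = barTensor R A (k + 1) (Fin.cons 1 a) := by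
  rw [barTensor_apply, barTensor_apply, barHtpy]
  simp only [TensorProduct.lift.tmul, LinearMap.mk₂_apply, LinearMap.comp_apply,
    PiTensorProduct.lift.tprod, MultilinearMap.curryLeft_apply, TensorProduct.mk_apply,
    Fin.cons_zero]
  congr 2
  refine funext fun j => ?_
  refine Fin.cases ?_ (fun j => ?_) j <;> simp

variable {R A}

theorem Bar.linearMap_ext {P : Type*} [AddCommMonoid P] [Module R P] {k : ℕ}
    {f g : Bar R A k →ₗ[R] P} (h : ∀ a, f (barTensor R A k a) = g (barTensor R A k a)) : f = g := by
  refine TensorProduct.ext ?_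
  refine TensorProduct.ext' fun α β => ?_
  refine PiTensorProduct.ext (MultilinearMap.ext fun a => ?_)
  have := h (Fin.cons α (Fin.snoc a β.unop : Fin (k + 1) → A))
  rw [barTensor_apply, ← Fin.succ_last] at this
  simpa using this

variable (R A) in
/-- The contraction `b ↦ 1 ⊗ b` of the augmentation of the bar resolution. -/
noncomputable def barSection : RegBimod R A →ₗ[R] Bar R A 0 :=
  let φ : A →ₗ[R] Bar R A 0 := (barTensor R A 0).toLinearMap ![1, 1] 1
  { toFun := fun a => φ (show A from a)
    map_add' := fun a b => φ.map_add (show A from a) (show A from b)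
    map_smul' := fun c a => φ.map_smul c (show A from a) }

theorem barSection_of (a : A) : barSection R A (RegBimod.of R a) = barTensor R A 0 ![1, a] := by
  change barTensor R A 0 (Function.update ![1, 1] 1 a) = _
  congr 1
  ext j
  fin_cases j <;> rfl

theorem barD_barHtpy_zero (x : Bar R A 0) :
    barD R A 0 (barHtpy R A 0 x) + barSection R A (barAug R A x) = x := by
  suffices H : (barD R A 0).restrictScalars R ∘ₗ barHtpy R A 0 +
      barSection R A ∘ₗ (barAug R A).restrictScalars R = LinearMap.id from LinearMap.congr_fun H x
  refine Bar.linearMap_ext fun a => ?_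
  simp only [LinearMap.comp_apply, LinearMap.restrictScalars_apply, LinearMap.add_apply,
    LinearMap.id_apply, barHtpy_tensor, barD_tensor, barAug_tensor, barSection_of]
  rw [Fin.sum_univ_two]
  have h0 : (0 : Fin 2).castSucc.contractNth (· * ·) (Fin.cons 1 a : Fin 3 → A) = a := by
    ext j
    fin_cases j <;> (simp [Fin.contractNth]; try rfl)
  have h1 : (1 : Fin 2).castSucc.contractNth (· * ·) (Fin.cons 1 a : Fin 3 → A) =
      ![1, a 0 * a 1] := by
    ext j
    fin_cases j <;> (simp [Fin.contractNth]; try rfl)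
  have h2 (t : Bar R A 0) : (-1 : R) • t + t = 0 := by
    conv_lhs => rw [← one_smul R t, smul_smul, ← add_smul, mul_one, neg_add_cancel, zero_smul]
  rw [h0, h1, Fin.val_zero, Fin.val_one, pow_zero, pow_one, one_smul, add_assoc, h2, add_zero]

theorem barD_barHtpy (k : ℕ) (x : Bar R A (k + 1)) :
    barD R A (k + 1) (barHtpy R A (k + 1) x) + barHtpy R A k (barD R A k x) = x := by
  suffices H : (barD R A (k + 1)).restrictScalars R ∘ₗ barHtpy R A (k + 1) +
      barHtpy R A k ∘ₗ (barD R A k).restrictScalars R = LinearMap.id from LinearMap.congr_fun H x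
  refine Bar.linearMap_ext fun a => ?_
  simp only [LinearMap.comp_apply, LinearMap.restrictScalars_apply, LinearMap.add_apply,
    LinearMap.id_apply, barHtpy_tensor, barD_tensor, map_sum, map_smul]
  have h0 : (0 : Fin (k + 3)).castSucc.contractNth (· * ·)
      (Fin.cons 1 a : Fin (k + 4) → A) = a := by
    ext j
    refine Fin.cases ?_ (fun j => ?_) j <;> simp [Fin.contractNth]
  have h1 (i : Fin (k + 2)) : i.succ.castSucc.contractNth (· * ·) (Fin.cons 1 a : Fin (k + 4) → A) =
      Fin.cons 1 (i.castSucc.contractNth (· * ·) a) := by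
    ext j
    refine Fin.cases ?_ (fun j => ?_) j <;> simp [Fin.contractNth]
  rw [Fin.sum_univ_succ, h0, add_assoc, ← Finset.sum_add_distrib, Finset.sum_eq_zero]
  · simp
  · intro i _
    rw [h1, ← add_smul]
    simp [pow_succ]

theorem eq_zero_of_add_eq_self {M : Type*} [AddGroup M] {a b : M} (h : a + b = b) : a = 0 :=
  add_eq_right.1 h

/-- The image of the contracting homotopy generates the bar resolution over `Aᵉ`. -/
theorem Bar.hom_ext_of_barHtpy {P : Type*} [AddCommMonoid P] [Module R P] [Module (Env R A) P]
    {k : ℕ} {f g : Bar R A (k + 1) →ₗ[Env R A] P}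
    (h : ∀ x, f (barHtpy R A k x) = g (barHtpy R A k x)) (x) : f x = g x := by
  induction x using TensorProduct.induction_on with
  | zero => rw [map_zero, map_zero]
  | add _ _ h₁ h₂ => rw [map_add, map_add, h₁, h₂]
  | tmul e y =>
    have h1 (y) : f (1 ⊗ₜ y) = g (1 ⊗ₜ y) := by
      induction y using PiTensorProduct.induction_on with
      | smul_tprod c a =>
        have h1 : barHtpy R A k (c • barTensor R A k (Fin.snoc a 1 : Fin (k + 2) → A)) =
            (1 : Env R A) ⊗ₜ[R] (c • PiTensorProduct.tprod R a) := by
          rw [map_smul, barHtpy_tensor, barTensor_apply, TensorProduct.tmul_smul,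
            ← Fin.succ_last, Algebra.TensorProduct.one_def]
          simp
        rw [← h1, h]
      | add _ _ h₁ h₂ => rw [TensorProduct.tmul_add, map_add, map_add, h₁, h₂]
    have h2 : e ⊗ₜ[R] y = e • ((1 : Env R A) ⊗ₜ[R] y) := by
      rw [TensorProduct.smul_tmul', smul_eq_mul, mul_one]
    rw [h2, map_smul, map_smul, h1]

theorem barAug_barD (x : Bar R A 1) : barAug R A (barD R A 0 x) = 0 := by
  refine Bar.hom_ext_of_barHtpy (f := barAug R A ∘ₗ barD R A 0) (g := 0) (fun x => ?_) x
  have h1 := congrArg (barAug R A) (barD_barHtpy_zero x)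
  have h2 (a : RegBimod R A) : barAug R A (barSection R A a) = a := by
    change barAug R A (barSection R A (RegBimod.of R (show A from a))) = _
    rw [barSection_of, barAug_tensor]
    exact congrArg (RegBimod.of R) (one_mul (show A from a))
  rw [map_add, h2] at h1
  exact eq_zero_of_add_eq_self h1

/-- By induction on `k`, the contraction formula shows that `d d h = 0`, and the image of `h`
generates. -/
theorem barD_barD (k : ℕ) (x : Bar R A (k + 2)) : barD R A k (barD R A (k + 1) x) = 0 := by
  induction k with
  | zero =>
    refine Bar.hom_ext_of_barHtpy (f := barD R A 0 ∘ₗ barD R A 1) (g := 0) (fun x => ?_) x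
    have h1 := congrArg (barD R A 0) (barD_barHtpy 0 x)
    have h2 := barD_barHtpy_zero (barD R A 0 x)
    rw [barAug_barD, map_zero, add_zero] at h2
    rw [map_add, h2] at h1
    exact eq_zero_of_add_eq_self (M := Bar R A 0) h1
  | succ k ih =>
    refine Bar.hom_ext_of_barHtpy (f := barD R A (k + 1) ∘ₗ barD R A (k + 2)) (g := 0)
      (fun x => ?_) x
    have h1 := congrArg (barD R A (k + 1)) (barD_barHtpy (k + 1) x)
    have h2 := barD_barHtpy k (barD R A (k + 1) x)
    rw [ih, map_zero, add_zero] at h2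
    rw [map_add, h2] at h1
    exact eq_zero_of_add_eq_self (M := Bar R A (k + 1)) h1

variable (R A) in
theorem isFreeResolution_bar (h : ∀ k, Module.Free (Env R A) (Bar R A k)) :
    IsFreeResolution (X := Bar R A) (barD R A) (barAug R A) := by
  refine ⟨h, fun a => ?_, fun x => ⟨fun hx => ?_, ?_⟩,
    fun k x => ⟨fun hx => ?_, ?_⟩⟩
  · refine ⟨barTensor R A 0 ![1, show A from a], ?_⟩
    rw [barAug_tensor]
    exact congrArg (RegBimod.of R) (one_mul (show A from a))
  · have := barD_barHtpy_zero x
    rw [hx, map_zero, add_zero] at this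
    exact ⟨_, this⟩
  · rintro ⟨y, rfl⟩
    exact barAug_barD y
  · have := barD_barHtpy k x
    rw [hx, map_zero, add_zero] at this
    exact ⟨_, this⟩
  · rintro ⟨y, rfl⟩
    exact barD_barD k y

end BarExact

/-! ### The matrix entries of the differential of the bar resolution -/

section Lists

/-- Contraction of two neighbours, in terms of lists. -/
theorem ofFn_contractNth {α : Type*} {k : ℕ} (op : α → α → α) (v : Fin (k + 1) → α) (j : Fin k) :
    ∃ l t, l.length = (j : ℕ) ∧ List.ofFn v = l ++ v j.castSucc :: v j.succ :: t ∧
      List.ofFn (j.castSucc.contractNth op v) = l ++ op (v j.castSucc) (v j.succ) :: t := by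
  have hj := j.2
  refine ⟨(List.ofFn v).take j, (List.ofFn v).drop (j + 2), by simp; omega, ?_, ?_⟩
  · refine List.ext_getElem (by simp; omega) fun i h1 h2 => ?_
    simp only [List.getElem_append, List.getElem_cons, List.getElem_ofFn, List.getElem_take,
      List.getElem_drop, List.length_take, List.length_ofFn]
    split_ifs
    · rfl
    · congr 1; ext; simp; omega
    · congr 1; ext; simp; omega
    · congr 1; ext; simp; omega
  · refine List.ext_getElem (by simp; omega) fun i h1 h2 => ?_
    simp only [List.getElem_append, List.getElem_cons, List.getElem_ofFn, List.getElem_take,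
      List.getElem_drop, List.length_take, List.length_ofFn, Fin.contractNth, Fin.val_castSucc]
    split_ifs
    all_goals first | omega | rfl | (congr 1; ext; simp; omega) | skip
    · congr 1 <;> congr 1 <;> (ext; simp; omega)

theorem eq_contractNth_of_ofFn {α : Type*} {k : ℕ} (op : α → α → α) {v : Fin (k + 1) → α}
    {w : Fin k → α} {l t : List α} {a b : α} (hv : List.ofFn v = l ++ a :: b :: t)
    (hw : List.ofFn w = l ++ op a b :: t) :
    ∃ j : Fin k, (j : ℕ) = l.length ∧ v j.castSucc = a ∧ v j.succ = b ∧
      w = j.castSucc.contractNth op v := by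
  have hk : l.length < k := by
    have := congrArg List.length hw
    simp at this
    omega
  obtain ⟨l', t', hl, h1, h2⟩ := ofFn_contractNth op v ⟨l.length, hk⟩
  rw [hv] at h1
  obtain ⟨rfl, h3⟩ := List.append_inj h1 hl.symm
  simp only [List.cons.injEq] at h3
  obtain ⟨ha, hb, rfl⟩ := h3
  refine ⟨⟨l.length, hk⟩, rfl, ha.symm, hb.symm, List.ofFn_injective ?_⟩
  rw [hw, h2, ← ha, ← hb]

end Lists

section Entries

variable {R : Type*} [CommRing R] {n : ℕ}

theorem barBasis_repr_barTensor (k : ℕ) (a : Fin (k + 2) → ExtAlg R n)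
    (w : Fin k → Finset (Fin n)) :
    (barBasis R n k).repr (barTensor R (ExtAlg R n) k a) w =
      (∏ j, (extBasis R n).repr (a j.castSucc.succ) (w j)) •
        (a 0 ⊗ₜ[R] MulOpposite.op (a (Fin.last _))) := by
  rw [barTensor_apply, barBasis, Algebra.TensorProduct.basis_repr_tmul, Finsupp.smul_apply,
    Finsupp.mapRange_apply, Basis.piTensorProduct_repr_tprod_apply, smul_eq_mul,
    ← Algebra.commutes, ← Algebra.smul_def]

/-- The factors `1, x_{σ₁}, …, x_{σₖ}, 1` of a basis element of the bar resolution. -/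
noncomputable def barPad (R : Type*) [CommRing R] {n k : ℕ} (v : Fin k → Finset (Fin n)) :
    Fin (k + 2) → ExtAlg R n :=
  Fin.cons 1 (Fin.snoc (fun j => extBasis R n (v j)) 1 : Fin (k + 1) → ExtAlg R n)

theorem barPad_zero {k : ℕ} (v : Fin k → Finset (Fin n)) : barPad R v 0 = 1 := rfl

theorem barPad_last {k : ℕ} (v : Fin k → Finset (Fin n)) : barPad R v (Fin.last _) = 1 := by
  rw [barPad, ← Fin.succ_last, Fin.cons_succ, Fin.snoc_last]

theorem barPad_succ {k : ℕ} (v : Fin k → Finset (Fin n)) (j : Fin k) :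
    barPad R v j.castSucc.succ = extBasis R n (v j) := by
  rw [barPad, Fin.cons_succ, Fin.snoc_castSucc]

/-- The contribution of the `i`-th face to a matrix entry of the differential. -/
noncomputable def barFace (R : Type*) [CommRing R] {n k : ℕ} (v : Fin (k + 1) → Finset (Fin n))
    (w : Fin k → Finset (Fin n)) (i : Fin (k + 2)) : Env R (ExtAlg R n) :=
  (∏ j, (extBasis R n).repr (i.castSucc.contractNth (· * ·) (barPad R v) j.castSucc.succ) (w j)) •
    (i.castSucc.contractNth (· * ·) (barPad R v) 0 ⊗ₜ[R]
      MulOpposite.op (i.castSucc.contractNth (· * ·) (barPad R v) (Fin.last _)))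

theorem barEntry_eq_sum (k : ℕ) (v : Fin (k + 1) → Finset (Fin n)) (w : Fin k → Finset (Fin n)) :
    barEntry R n k v w = ∑ i : Fin (k + 2), (-1 : R) ^ (i : ℕ) • barFace R v w i := by
  have h1 : barBasis R n (k + 1) v = barTensor R (ExtAlg R n) (k + 1) (barPad R v) :=
    barBasis_apply R n (k + 1) v
  have h2 (c : R) (x : Bar R (ExtAlg R n) k) :
      (barBasis R n k).repr (c • x) w = c • (barBasis R n k).repr x w := by
    rw [← algebraMap_smul (Env R (ExtAlg R n)) c x, map_smul, Finsupp.smul_apply, algebraMap_smul]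
  rw [barEntry, h1, barD_tensor, map_sum, Finsupp.finsetSum_apply]
  simp only [h2, barBasis_repr_barTensor, barFace]

/-- The elements with some inner factor `1` span a subcomplex: the two faces next to that factor
cancel, and the other faces keep it. -/
theorem barEntry_eq_zero_of_empty (k : ℕ) (v : Fin (k + 1) → Finset (Fin n))
    (w : Fin k → Finset (Fin n)) (hw : ∀ j, (w j).Nonempty) (j : Fin (k + 1)) (hj : v j = ∅) :
    barEntry R n k v w = 0 := by
  have hp : barPad R v j.castSucc.succ = 1 := by rw [barPad_succ, hj, extBasis_empty]
  have hz (i : Fin (k + 2)) (l : Fin k)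
      (h : i.castSucc.contractNth (· * ·) (barPad R v) l.castSucc.succ = 1) :
      barFace R v w i = 0 := by
    rw [barFace, Finset.prod_eq_zero (Finset.mem_univ l), zero_smul]
    rw [h, ← extBasis_empty, Module.Basis.repr_self, Finsupp.single_eq_of_ne]
    exact (hw l).ne_empty
  have heq : j.castSucc.castSucc.contractNth (· * ·) (barPad R v) =
      j.succ.castSucc.contractNth (· * ·) (barPad R v) := by
    have h0 (m : ℕ) (hm : m < k + 3) (h : m = j + 1) : barPad R v ⟨m, hm⟩ = 1 := by
      subst h; exact hp
    ext q
    simp only [Fin.contractNth, Fin.val_castSucc, Fin.val_succ]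
    have hq := q.2
    split_ifs
    all_goals first
      | omega
      | rfl
      | skip
    · rw [show q.castSucc = ⟨q, by omega⟩ from rfl, show q.succ = ⟨q + 1, by omega⟩ from rfl,
        h0 (q + 1) (by omega) (by omega), mul_one]
    · rw [show q.castSucc = ⟨q, by omega⟩ from rfl, show q.succ = ⟨q + 1, by omega⟩ from rfl,
        h0 q (by omega) (by omega), one_mul]
  rw [barEntry_eq_sum, Finset.sum_eq_add j.castSucc j.succ (Fin.castSucc_lt_succ).ne]
  · rw [show barFace R v w j.succ = barFace R v w j.castSucc by rw [barFace, barFace, heq],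
      ← add_smul]
    simp [pow_succ]
  · intro i _ hi
    have h1 : (i : ℕ) ≠ j := fun h => hi.1 (Fin.ext h)
    have h2 : (i : ℕ) ≠ j + 1 := fun h => hi.2 (Fin.ext h)
    have hi2 := i.2
    have hj2 := j.2
    rw [show barFace R v w i = 0 from ?_, smul_zero]
    rcases lt_or_gt_of_ne h1 with h | h
    · refine hz i ⟨j - 1, by omega⟩ ?_
      rw [Fin.contractNth_apply_of_gt, ← hp]
      · congr 1; ext; simp; omega
      · simp; omega
    · refine hz i ⟨j, by omega⟩ ?_
      rw [Fin.contractNth_apply_of_lt, ← hp]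
      · congr 1
      · simp; omega
  · simp
  · simp

theorem barFace_zero (k : ℕ) (v : Fin (k + 1) → Finset (Fin n)) (w : Fin k → Finset (Fin n)) :
    barFace R v w 0 = if Fin.tail v = w then extBasis R n (v 0) ⊗ₜ 1 else 0 := by
  have h1 (j : Fin k) : (0 : Fin (k + 2)).castSucc.contractNth (· * ·) (barPad R v)
      j.castSucc.succ = extBasis R n (v j.succ) := by
    rw [Fin.contractNth_apply_of_gt _ _ _ _ (by simp), ← barPad_succ]
    congr 1
  have h2 : (0 : Fin (k + 2)).castSucc.contractNth (· * ·) (barPad R v) 0 = extBasis R n (v 0) := by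
    rw [Fin.contractNth_apply_of_eq _ _ _ _ (by simp), Fin.castSucc_zero, barPad_zero, one_mul]
    exact barPad_succ v 0
  have h3 : (0 : Fin (k + 2)).castSucc.contractNth (· * ·) (barPad R v) (Fin.last _) = 1 := by
    rw [Fin.contractNth_apply_of_gt _ _ _ _ (by simp), Fin.succ_last, barPad_last]
  rw [barFace, h2, h3, MulOpposite.op_one]
  simp only [h1, Module.Basis.repr_self]
  split_ifs with h
  · subst h
    rw [Finset.prod_eq_one, one_smul]
    intro j _
    simp [Fin.tail]
  · obtain ⟨j, hj⟩ := Function.ne_iff.1 h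
    rw [Finset.prod_eq_zero (Finset.mem_univ j), zero_smul]
    exact Finsupp.single_eq_of_ne hj.symm

theorem barFace_last (k : ℕ) (v : Fin (k + 1) → Finset (Fin n)) (w : Fin k → Finset (Fin n)) :
    barFace R v w (Fin.last _) =
      if Fin.init v = w then 1 ⊗ₜ MulOpposite.op (extBasis R n (v (Fin.last k))) else 0 := by
  have h1 (j : Fin k) : (Fin.last (k + 1)).castSucc.contractNth (· * ·) (barPad R v)
      j.castSucc.succ = extBasis R n (v j.castSucc) := by
    rw [Fin.contractNth_apply_of_lt _ _ _ _ (by simp), ← barPad_succ]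
    congr 1
  have h2 : (Fin.last (k + 1)).castSucc.contractNth (· * ·) (barPad R v) 0 = 1 := by
    rw [Fin.contractNth_apply_of_lt _ _ _ _ (by simp), Fin.castSucc_zero, barPad_zero]
  have h3 : (Fin.last (k + 1)).castSucc.contractNth (· * ·) (barPad R v) (Fin.last _) =
      extBasis R n (v (Fin.last k)) := by
    rw [Fin.contractNth_apply_of_eq _ _ _ _ (by simp), Fin.succ_last, barPad_last, mul_one]
    exact barPad_succ v (Fin.last k)
  rw [barFace, h2, h3]
  simp only [h1, Module.Basis.repr_self]
  split_ifs with h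
  · subst h
    rw [Finset.prod_eq_one, one_smul]
    intro j _
    simp [Fin.init]
  · obtain ⟨j, hj⟩ := Function.ne_iff.1 h
    rw [Finset.prod_eq_zero (Finset.mem_univ j), zero_smul]
    exact Finsupp.single_eq_of_ne hj.symm

theorem repr_extBasis_mul_of_ne {σ τ ρ : Finset (Fin n)} (h : ¬ (Disjoint σ τ ∧ σ ∪ τ = ρ)) :
    (extBasis R n).repr (extBasis R n σ * extBasis R n τ) ρ = 0 := by
  by_cases hd : Disjoint σ τ
  · obtain ⟨s, hs⟩ := extBasis_mul_of_disjoint R hd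
    have hne : ρ ≠ σ ∪ τ := fun h' => h ⟨hd, h'.symm⟩
    rcases Int.units_eq_one_or s with rfl | rfl <;> rw [hs] <;> simp [hne]
  · rw [extBasis_mul_of_not_disjoint R hd]
    simp

theorem barFace_middle (k : ℕ) (v : Fin (k + 1) → Finset (Fin n)) (w : Fin k → Finset (Fin n))
    (i : Fin k) : barFace R v w i.castSucc.succ =
      if Disjoint (v i.castSucc) (v i.succ) ∧ i.castSucc.contractNth (· ∪ ·) v = w then
        algebraMap R _ ((extBasis R n).repr
          (extBasis R n (v i.castSucc) * extBasis R n (v i.succ)) (v i.castSucc ∪ v i.succ))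
      else 0 := by
  have h2 : i.castSucc.succ.castSucc.contractNth (· * ·) (barPad R v) 0 = 1 := by
    rw [Fin.contractNth_apply_of_lt _ _ _ _ (by simp), Fin.castSucc_zero, barPad_zero]
  have h3 : i.castSucc.succ.castSucc.contractNth (· * ·) (barPad R v) (Fin.last _) = 1 := by
    rw [Fin.contractNth_apply_of_gt _ _ _ _ (by simp), Fin.succ_last, barPad_last]
  have h1 (j : Fin k) (hj : j ≠ i) : i.castSucc.succ.castSucc.contractNth (· * ·) (barPad R v)
      j.castSucc.succ = extBasis R n (i.castSucc.contractNth (· ∪ ·) v j) := by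
    rcases lt_or_gt_of_ne hj with h | h
    · rw [Fin.contractNth_apply_of_lt _ _ _ _ (by simpa using h),
        Fin.contractNth_apply_of_lt _ _ _ _ (by simpa using h), ← barPad_succ]
      congr 1
    · rw [Fin.contractNth_apply_of_gt _ _ _ _ (by simpa using h),
        Fin.contractNth_apply_of_gt _ _ _ _ (by simpa using h), ← barPad_succ]
      congr 1
  have h4 : i.castSucc.succ.castSucc.contractNth (· * ·) (barPad R v) i.castSucc.succ =
      extBasis R n (v i.castSucc) * extBasis R n (v i.succ) := by
    rw [Fin.contractNth_apply_of_eq _ _ _ _ (by simp), ← barPad_succ, ← barPad_succ]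
    congr 1
  have h5 : i.castSucc.contractNth (· ∪ ·) v i = v i.castSucc ∪ v i.succ :=
    Fin.contractNth_apply_of_eq _ _ _ _ (by simp)
  rw [barFace, h2, h3, MulOpposite.op_one, ← Algebra.TensorProduct.one_def,
    ← Algebra.algebraMap_eq_smul_one]
  split_ifs with h
  · obtain ⟨hd, rfl⟩ := h
    congr 1
    rw [Fintype.prod_eq_single i, h4, h5]
    intro j hj
    rw [h1 j hj]
    simp
  · rw [show (∏ j, _ : R) = 0 from ?_, map_zero]
    by_cases hi : Disjoint (v i.castSucc) (v i.succ) ∧ v i.castSucc ∪ v i.succ = w i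
    · have : i.castSucc.contractNth (· ∪ ·) v ≠ w := fun h' => h ⟨hi.1, h'⟩
      obtain ⟨j, hj⟩ := Function.ne_iff.1 this
      have hji : j ≠ i := by rintro rfl; exact hj (h5.trans hi.2)
      refine Finset.prod_eq_zero (Finset.mem_univ j) ?_
      rw [h1 j hji, Module.Basis.repr_self]
      exact Finsupp.single_eq_of_ne hj.symm
    · refine Finset.prod_eq_zero (Finset.mem_univ i) ?_
      rw [h4, repr_extBasis_mul_of_ne hi]

theorem barEntry_eq (k : ℕ) (v : Fin (k + 1) → Finset (Fin n)) (w : Fin k → Finset (Fin n)) :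
    barEntry R n k v w = barFace R v w 0 +
      (∑ i : Fin k, (-1 : R) ^ (i + 1 : ℕ) • barFace R v w i.castSucc.succ +
      (-1 : R) ^ (k + 1) • barFace R v w (Fin.last _)) := by
  rw [barEntry_eq_sum, Fin.sum_univ_succ, Fin.sum_univ_castSucc]
  simp

end Entries

/-! ### The matching on lists of subsets -/

section ListMatch

variable {n : ℕ}

/-- The matching in recursive form, on lists of subsets: `ListMatch b L L'` means that `L` and `L'`
are the source and the target of an edge of the matching, and that the increasing sequence
`i₁ ≤ ⋯ ≤ iᵣ₋₁ ≤ i` of this edge is bounded below by `b`. The bound makes the recursion possible. -/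
inductive ListMatch : ℕ → List (Finset (Fin n)) → List (Finset (Fin n)) → Prop
  | base {b : ℕ} {i : Fin n} {σ : Finset (Fin n)} {t : List (Finset (Fin n))} (hb : b ≤ i)
      (hi : IsGreatest (σ : Set (Fin n)) i) (hne : (σ.erase i).Nonempty) :
      ListMatch b ({i} :: σ.erase i :: t) (σ :: t)
  | step {b : ℕ} {a : Fin n} {L L' : List (Finset (Fin n))} (hb : b ≤ a)
      (h : ListMatch a L L') : ListMatch b ({a} :: L) ({a} :: L')

namespace ListMatch

theorem of_pairwise {i : Fin n} {σ : Finset (Fin n)} {t : List (Finset (Fin n))}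
    (hi : IsGreatest (σ : Set (Fin n)) i) (hne : (σ.erase i).Nonempty) :
    ∀ {l : List (Fin n)} {b : ℕ}, (l ++ [i]).Pairwise (· ≤ ·) → (∀ x ∈ l ++ [i], b ≤ (x : ℕ)) →
      ListMatch b (l.map (fun a => {a}) ++ {i} :: σ.erase i :: t) (l.map (fun a => {a}) ++ σ :: t)
  | [], b, _, hb => .base (hb i (by simp)) hi hne
  | a :: l, b, hp, hb => by
    rw [List.cons_append, List.pairwise_cons] at hp
    exact .step (hb a (by simp)) (of_pairwise hi hne hp.2 fun x hx => hp.1 x hx)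

theorem exists_pairwise {b : ℕ} {L L' : List (Finset (Fin n))} (h : ListMatch b L L') :
    ∃ (l : List (Fin n)) (i : Fin n) (σ : Finset (Fin n)) (t : List (Finset (Fin n))),
      (l ++ [i]).Pairwise (· ≤ ·) ∧ (∀ x ∈ l ++ [i], b ≤ (x : ℕ)) ∧
      IsGreatest (σ : Set (Fin n)) i ∧ (σ.erase i).Nonempty ∧
      L = l.map (fun a => {a}) ++ {i} :: σ.erase i :: t ∧ L' = l.map (fun a => {a}) ++ σ :: t := by
  induction h with
  | @base b i σ t hb hi hne => exact ⟨[], i, σ, t, by simp, by simpa, hi, hne, rfl, rfl⟩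
  | @step b a L L' hb _ ih =>
    obtain ⟨l, i, σ, t, h1, h2, h3, h4, rfl, rfl⟩ := ih
    refine ⟨a :: l, i, σ, t, ?_, ?_, h3, h4, rfl, rfl⟩
    · rw [List.cons_append, List.pairwise_cons]
      exact ⟨fun x hx => h2 x hx, h1⟩
    · intro x hx
      rw [List.cons_append, List.mem_cons] at hx
      rcases hx with rfl | hx
      · exact hb
      · exact hb.trans (h2 x hx)

theorem lt_of_mem_erase {i a : Fin n} {σ : Finset (Fin n)}
    (hi : IsGreatest (σ : Set (Fin n)) i) (ha : a ∈ σ.erase i) : a < i :=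
  lt_of_le_of_ne (hi.2 (Finset.mem_of_mem_erase ha)) (Finset.ne_of_mem_erase ha)

/-- The first set of a source contains an element that is at least the bound. -/
theorem exists_head_source {b : ℕ} {σ : Finset (Fin n)} {t L' : List (Finset (Fin n))}
    (h : ListMatch b (σ :: t) L') : ∃ a ∈ σ, b ≤ (a : ℕ) := by
  cases h with
  | base hb => exact ⟨_, by simp, hb⟩
  | step hb => exact ⟨_, by simp, hb⟩

theorem exists_head_target {b : ℕ} {σ : Finset (Fin n)} {t L : List (Finset (Fin n))}
    (h : ListMatch b L (σ :: t)) : ∃ a ∈ σ, b ≤ (a : ℕ) := by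
  cases h with
  | base hb hi => exact ⟨_, hi.1, hb⟩
  | step hb => exact ⟨_, by simp, hb⟩

theorem false_of_head_erase {i : Fin n} {σ : Finset (Fin n)}
    (hi : IsGreatest (σ : Set (Fin n)) i) (h : ∃ a ∈ σ.erase i, (i : ℕ) ≤ a) : False := by
  obtain ⟨a, ha, hia⟩ := h
  exact absurd (lt_of_mem_erase hi ha) (not_lt.2 hia)

theorem target_unique {b : ℕ} {L L₁ : List (Finset (Fin n))} (h₁ : ListMatch b L L₁) :
    ∀ {L₂}, ListMatch b L L₂ → L₁ = L₂ := by
  induction h₁ with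
  | @base b i σ t hb hi hne =>
    intro L₂ h₂
    generalize hL : ({i} :: σ.erase i :: t : List (Finset (Fin n))) = L at h₂
    cases h₂ with
    | @base _ i' σ' t' hb' hi' hne' =>
      simp only [List.cons.injEq, Finset.singleton_inj] at hL
      obtain ⟨rfl, h1, rfl⟩ := hL
      rw [← Finset.insert_erase hi.1, h1, Finset.insert_erase hi'.1]
    | @step _ a L L' hb' h' =>
      simp only [List.cons.injEq, Finset.singleton_inj] at hL
      obtain ⟨rfl, rfl⟩ := hL
      exact (false_of_head_erase hi h'.exists_head_source).elim
  | @step b a L L' hb h ih =>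
    intro L₂ h₂
    generalize hL : ({a} :: L : List (Finset (Fin n))) = L₀ at h₂
    cases h₂ with
    | @base _ i' σ' t' hb' hi' hne' =>
      simp only [List.cons.injEq, Finset.singleton_inj] at hL
      obtain ⟨rfl, rfl⟩ := hL
      exact (false_of_head_erase hi' h.exists_head_source).elim
    | @step _ a' L'' L''' hb' h' =>
      simp only [List.cons.injEq, Finset.singleton_inj] at hL
      obtain ⟨rfl, rfl⟩ := hL
      rw [ih h']

theorem source_unique {b : ℕ} {L L₁ : List (Finset (Fin n))} (h₁ : ListMatch b L₁ L) :
    ∀ {L₂}, ListMatch b L₂ L → L₁ = L₂ := by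
  induction h₁ with
  | @base b i σ t hb hi hne =>
    intro L₂ h₂
    cases h₂ with
    | @base _ i' _ _ hb' hi' hne' => rw [hi.unique hi']
    | @step _ a L L' hb' h' =>
      obtain rfl : i = a := by simpa using hi.1
      simp at hne
  | @step b a L L' hb h ih =>
    intro L₂ h₂
    generalize hL : ({a} :: L' : List (Finset (Fin n))) = L₀ at h₂
    cases h₂ with
    | @base _ i' σ' t' hb' hi' hne' =>
      simp only [List.cons.injEq] at hL
      obtain ⟨rfl, rfl⟩ := hL
      obtain rfl : i' = a := by simpa using hi'.1
      simp at hne'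
    | @step _ a' L'' L''' hb' h' =>
      simp only [List.cons.injEq, Finset.singleton_inj] at hL
      obtain ⟨rfl, rfl⟩ := hL
      rw [ih h']

theorem not_both {b b' : ℕ} {L L' : List (Finset (Fin n))} (h₁ : ListMatch b L L') :
    ∀ {L₀}, ¬ ListMatch b' L₀ L := by
  induction h₁ generalizing b' with
  | @base b i σ t hb hi hne =>
    intro L₀ h₂
    generalize hL : ({i} :: σ.erase i :: t : List (Finset (Fin n))) = L at h₂
    cases h₂ with
    | @base _ i' σ' t' hb' hi' hne' =>
      simp only [List.cons.injEq] at hL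
      obtain ⟨rfl, rfl⟩ := hL
      obtain rfl : i' = i := by simpa using hi'.1
      simp at hne'
    | @step _ a L L' hb' h' =>
      simp only [List.cons.injEq, Finset.singleton_inj] at hL
      obtain ⟨rfl, rfl⟩ := hL
      exact false_of_head_erase hi h'.exists_head_target
  | @step b a L L' hb h ih =>
    intro L₀ h₂
    generalize hL : ({a} :: L : List (Finset (Fin n))) = L₁ at h₂
    cases h₂ with
    | @base _ i' σ' t' hb' hi' hne' =>
      simp only [List.cons.injEq] at hL
      obtain ⟨rfl, rfl⟩ := hL
      obtain rfl : i' = a := by simpa using hi'.1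
      simp at hne'
    | @step _ a' L'' L''' hb' h' =>
      simp only [List.cons.injEq, Finset.singleton_inj] at hL
      obtain ⟨rfl, rfl⟩ := hL
      exact ih h'

/-- Every list is a source, a target or an increasing list of singletons: along the longest initial
segment of increasing singletons, the next set decides. If it has several elements and its maximum
continues the increase, the list is a target; if all its elements are smaller than the preceding
one, the list is a source. -/
theorem trichotomy : ∀ (L : List (Finset (Fin n))) (b : ℕ), (∀ σ ∈ L, σ.Nonempty) →
    (∀ σ ∈ L.head?, ∃ a ∈ σ, b ≤ (a : ℕ)) →
    (∃ L', ListMatch b L L') ∨ (∃ L', ListMatch b L' L) ∨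
      ∃ l : List (Fin n), l.Pairwise (· ≤ ·) ∧ (∀ x ∈ l, b ≤ (x : ℕ)) ∧ L = l.map (fun a => {a})
  | [], b, _, _ => .inr (.inr ⟨[], by simp⟩)
  | σ :: t, b, hne, hb => by
    have hσ : σ.Nonempty := hne σ (by simp)
    have hi := Finset.isGreatest_max' σ hσ
    obtain ⟨a, ha, hba⟩ := hb σ (by simp)
    have hbi : b ≤ (σ.max' hσ : ℕ) := hba.trans (hi.2 ha)
    generalize σ.max' hσ = i at hi hbi
    rcases (σ.erase i).eq_empty_or_nonempty with he | he
    · obtain rfl : σ = {i} := by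
        rw [Finset.erase_eq_empty_iff] at he
        exact he.resolve_left hσ.ne_empty
      by_cases ht : ∀ ρ ∈ t.head?, ∃ a ∈ ρ, (i : ℕ) ≤ a
      · rcases trichotomy t i (fun ρ hρ => hne ρ (by simp [hρ])) ht with
          ⟨L', h⟩ | ⟨L', h⟩ | ⟨l, h1, h2, rfl⟩
        · exact .inl ⟨_, .step hbi h⟩
        · exact .inr (.inl ⟨_, .step hbi h⟩)
        · refine .inr (.inr ⟨i :: l, ?_, ?_, rfl⟩)
          · exact List.pairwise_cons.2 ⟨fun x hx => h2 x hx, h1⟩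
          · intro x hx
            rcases List.mem_cons.1 hx with rfl | hx
            exacts [hbi, hbi.trans (h2 x hx)]
      · push Not at ht
        obtain ⟨ρ, hρ, hlt⟩ := ht
        obtain ⟨t, rfl⟩ : ∃ t', t = ρ :: t' := by
          cases t with
          | nil => simp at hρ
          | cons x t => simp at hρ; exact ⟨t, by rw [hρ]⟩
        left
        have hni : i ∉ ρ := fun h => (hlt i h).false
        refine ⟨insert i ρ :: t, ?_⟩
        have := ListMatch.base (t := t) (σ := insert i ρ) hbi ?_ ?_
        · rwa [Finset.erase_insert hni] at this
        · refine ⟨by simp, fun x hx => ?_⟩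
          rw [Finset.coe_insert] at hx
          rcases hx with rfl | hx
          exacts [le_rfl, le_of_lt (hlt x hx)]
        · rw [Finset.erase_insert hni]
          exact hne ρ (by simp)
    · exact .inr (.inl ⟨_, .base hbi hi he⟩)

theorem not_target_singletons {b : ℕ} {L L' : List (Finset (Fin n))} (h : ListMatch b L L') :
    ∃ σ ∈ L', 1 < σ.card := by
  induction h with
  | @base b i σ t hb hi hne =>
    refine ⟨σ, by simp, ?_⟩
    have := Finset.card_erase_add_one hi.1
    have := hne.card_pos
    omega
  | step _ _ ih =>
    obtain ⟨σ, hσ, h⟩ := ih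
    exact ⟨σ, by simp [hσ], h⟩

theorem not_source_of_pairwise {b : ℕ} {L L' : List (Finset (Fin n))} (h : ListMatch b L L')
    {l : List (Fin n)} (hl : l.Pairwise (· ≤ ·)) : L ≠ l.map (fun a => {a}) := by
  induction h generalizing l with
  | @base b i σ t hb hi hne =>
    rintro h
    match l, h with
    | [x], h => simp at h
    | x :: y :: l, h =>
      simp only [List.map_cons, List.cons.injEq, Finset.singleton_inj] at h
      obtain ⟨rfl, h, -⟩ := h
      have h1 : y ∈ σ.erase i := by simp [h]
      exact absurd (lt_of_mem_erase hi h1) (not_lt.2 ((List.pairwise_cons.1 hl).1 y (by simp)))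
  | @step b a L L' hb h' ih =>
    intro h
    match l, h with
    | x :: l, h =>
      simp only [List.map_cons, List.cons.injEq, Finset.singleton_inj] at h
      exact ih (List.pairwise_cons.1 hl).2 h.2

theorem length_eq {b : ℕ} {L L' : List (Finset (Fin n))} (h : ListMatch b L L') :
    L.length = L'.length + 1 := by
  induction h with
  | base => simp
  | step _ _ ih => simp [ih]

theorem nonempty_target {b : ℕ} {L L' : List (Finset (Fin n))} (h : ListMatch b L L')
    (hL : ∀ σ ∈ L, σ.Nonempty) : ∀ σ ∈ L', σ.Nonempty := by
  induction h with
  | base _ hi _ =>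
    simp only [List.mem_cons, forall_eq_or_imp] at hL ⊢
    exact ⟨⟨_, hi.1⟩, hL.2.2⟩
  | step _ _ ih =>
    simp only [List.mem_cons, forall_eq_or_imp] at hL ⊢
    exact ⟨hL.1, ih hL.2⟩

theorem nonempty_source {b : ℕ} {L L' : List (Finset (Fin n))} (h : ListMatch b L L')
    (hL : ∀ σ ∈ L', σ.Nonempty) : ∀ σ ∈ L, σ.Nonempty := by
  induction h with
  | base _ hi hne =>
    simp only [List.mem_cons, forall_eq_or_imp] at hL ⊢
    exact ⟨by simp, hne, hL.2⟩
  | step _ _ ih =>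
    simp only [List.mem_cons, forall_eq_or_imp] at hL ⊢
    exact ⟨hL.1, ih hL.2⟩

end ListMatch

end ListMatch

/-! ### A potential for the digraph -/

section Potential

variable {n : ℕ}

/-- The multiset of all elements of the sets of a list. -/
def listContent (L : List (Finset (Fin n))) : Multiset (Fin n) :=
  (L.map Finset.val).sum

/-- The number of pairs `(a, b) ∈ σ × τ` with `a ≤ b`. -/
def nonInv (σ τ : Finset (Fin n)) : ℕ := ∑ a ∈ σ, ∑ b ∈ τ, if a ≤ b then 1 else 0

/-- The number of pairs `a ≤ b` such that `a` lies in an earlier set of the list than `b`. These are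
the non-inversions of the word that is obtained by writing each set in decreasing order. -/
def listNonInv : List (Finset (Fin n)) → ℕ
  | [] => 0
  | σ :: L => (L.map (nonInv σ)).sum + listNonInv L

@[simp]
theorem listContent_nil : listContent ([] : List (Finset (Fin n))) = 0 := rfl

@[simp]
theorem listContent_cons (σ : Finset (Fin n)) (L : List (Finset (Fin n))) :
    listContent (σ :: L) = σ.val + listContent L := by simp [listContent]

@[simp]
theorem listContent_append (L L' : List (Finset (Fin n))) :
    listContent (L ++ L') = listContent L + listContent L' := by simp [listContent]

theorem listContent_map_singleton (l : List (Fin n)) :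
    listContent (l.map fun a => {a}) = (l : Multiset (Fin n)) := by
  induction l with
  | nil => rfl
  | cons a l ih => simp [ih]

theorem union_val_of_disjoint {σ τ : Finset (Fin n)} (h : Disjoint σ τ) :
    (σ ∪ τ).val = σ.val + τ.val := by
  rw [← Finset.disjUnion_eq_union σ τ h]
  rfl

theorem nonInv_union_left {σ τ : Finset (Fin n)} (h : Disjoint σ τ) (ρ : Finset (Fin n)) :
    nonInv (σ ∪ τ) ρ = nonInv σ ρ + nonInv τ ρ := Finset.sum_union h

theorem nonInv_union_right {σ τ : Finset (Fin n)} (h : Disjoint σ τ) (ρ : Finset (Fin n)) :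
    nonInv ρ (σ ∪ τ) = nonInv ρ σ + nonInv ρ τ := by
  simp only [nonInv, Finset.sum_union h, Finset.sum_add_distrib]

theorem lt_of_nonInv_eq_zero {σ τ : Finset (Fin n)} (h : nonInv σ τ = 0) {a b : Fin n}
    (ha : a ∈ σ) (hb : b ∈ τ) : b < a := by
  by_contra hab
  rw [nonInv, Finset.sum_eq_zero_iff] at h
  have h1 := h a ha
  rw [Finset.sum_eq_zero_iff] at h1
  simpa [not_lt.1 hab] using h1 b hb

theorem listNonInv_merge {σ τ : Finset (Fin n)} (h : Disjoint σ τ) (t : List (Finset (Fin n))) :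
    ∀ l : List (Finset (Fin n)),
      listNonInv (l ++ σ :: τ :: t) = listNonInv (l ++ (σ ∪ τ) :: t) + nonInv σ τ
  | [] => by
    have : (t.map (nonInv (σ ∪ τ))).sum = (t.map (nonInv σ)).sum + (t.map (nonInv τ)).sum := by
      rw [← List.sum_map_add]
      exact congrArg (fun f => (t.map f).sum) (funext (nonInv_union_left h))
    simp only [List.nil_append, listNonInv, List.map_cons, List.sum_cons, this]
    ring
  | ρ :: l => by
    have := listNonInv_merge h t l
    simp only [List.cons_append, listNonInv, this, List.map_append, List.map_cons,
      List.sum_append, List.sum_cons, nonInv_union_right h]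
    ring

theorem listNonInv_append_singleton (σ : Finset (Fin n)) (l : List (Finset (Fin n))) :
    listNonInv l ≤ listNonInv (l ++ [σ]) := by
  induction l with
  | nil => simp [listNonInv]
  | cons ρ l ih =>
    simp only [List.cons_append, listNonInv, List.map_append, List.sum_append]
    omega

theorem ListMatch.listContent_eq {b : ℕ} {L L' : List (Finset (Fin n))} (h : ListMatch b L L') :
    listContent L = listContent L' := by
  induction h with
  | @base b i σ t hb hi hne =>
    rw [listContent_cons, listContent_cons, listContent_cons, ← add_assoc, Finset.erase_val,
      Finset.singleton_val, Multiset.singleton_add, Multiset.cons_erase hi.1]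
  | step _ _ ih => simp [ih]

theorem ListMatch.listNonInv_eq {b : ℕ} {L L' : List (Finset (Fin n))} (h : ListMatch b L L') :
    listNonInv L = listNonInv L' := by
  obtain ⟨l, i, σ, t, -, -, hi, -, rfl, rfl⟩ := h.exists_pairwise
  rw [listNonInv_merge (σ := {i}) (τ := σ.erase i) (by simp), ← Finset.insert_eq,
    Finset.insert_erase hi.1, add_eq_left, nonInv, Finset.sum_singleton]
  refine Finset.sum_eq_zero fun a ha => if_neg (not_le.2 (ListMatch.lt_of_mem_erase hi ha))

/-- A merge that creates no new inversion and ends in a target of the matching starts in a target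
or belongs to the matching. -/
theorem ListMatch.of_merge {σ τ : Finset (Fin n)} (hσ : σ.Nonempty) (hτ : τ.Nonempty)
    (h : nonInv σ τ = 0) {t : List (Finset (Fin n))} :
    ∀ {l : List (Finset (Fin n))} {b : ℕ} {L : List (Finset (Fin n))},
      ListMatch b L (l ++ (σ ∪ τ) :: t) →
      ListMatch b (l ++ σ :: τ :: t) (l ++ (σ ∪ τ) :: t) ∨
        ∃ L', ListMatch b L' (l ++ σ :: τ :: t)
  | [], b, L, hL => by
    have hlt : ∀ a ∈ σ, ∀ c ∈ τ, c < a := fun a ha c hc => lt_of_nonInv_eq_zero h ha hc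
    obtain ⟨x, hx⟩ := hσ
    obtain ⟨y, hy⟩ := hτ
    generalize hL' : ([] ++ (σ ∪ τ) :: t : List (Finset (Fin n))) = L' at hL
    cases hL with
    | @base _ i ρ t' hb hi hne =>
      simp only [List.nil_append, List.cons.injEq] at hL'
      obtain ⟨rfl, rfl⟩ := hL'
      have hiσ : i ∈ σ := by
        have h1 : i ∈ σ ∪ τ := hi.1
        rcases Finset.mem_union.1 h1 with h1 | h1
        · exact h1
        · exact absurd (hlt x hx i h1) (not_lt.2 (hi.2 (by simp [hx])))
      have hiτ : i ∉ τ := fun h' => (hlt i hiσ i h').false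
      have hgσ : IsGreatest (σ : Set (Fin n)) i := ⟨hiσ, fun a ha => hi.2 (by
        rw [Finset.coe_union]; exact .inl ha)⟩
      rcases (σ.erase i).eq_empty_or_nonempty with he | he
      · left
        obtain rfl : σ = {i} := by
          rw [Finset.erase_eq_empty_iff] at he
          exact he.resolve_left (Finset.ne_empty_of_mem hx)
        have h1 : (({i} : Finset (Fin n)) ∪ τ).erase i = τ := by
          rw [← Finset.insert_eq, Finset.erase_insert hiτ]
        have h2 := ListMatch.base (t := t) hb hi hne
        rwa [h1] at h2
      · exact .inr ⟨_, .base hb hgσ he⟩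
    | @step _ a L₁ L₁' hb h' =>
      simp only [List.nil_append, List.cons.injEq] at hL'
      have hxa : x ∈ ({a} : Finset (Fin n)) := by rw [← hL'.1]; simp [hx]
      have hya : y ∈ ({a} : Finset (Fin n)) := by rw [← hL'.1]; simp [hy]
      rw [Finset.mem_singleton] at hxa hya
      exact absurd (hlt x hx y hy) (by rw [hxa, hya]; exact lt_irrefl _)
  | ρ :: l, b, L, hL => by
    generalize hL' : (ρ :: l ++ (σ ∪ τ) :: t : List (Finset (Fin n))) = L' at hL
    cases hL with
    | @base _ i ρ' t' hb hi hne =>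
      simp only [List.cons_append, List.cons.injEq] at hL'
      obtain ⟨rfl, rfl⟩ := hL'
      exact .inr ⟨_, .base hb hi hne⟩
    | @step _ a L₁ L₁' hb h' =>
      simp only [List.cons_append, List.cons.injEq] at hL'
      obtain ⟨rfl, rfl⟩ := hL'
      rcases ListMatch.of_merge hσ hτ h h' with h1 | ⟨L₂, h1⟩
      · exact .inl (.step hb h1)
      · exact .inr ⟨_, .step hb h1⟩

open Classical in
/-- The potential of a list in degree `k`. It decreases along every edge of the digraph: edges of
the differential lower the degree and do not raise the remaining part; reversed edges raise the
degree by one, preserve content and non-inversions and turn a target of the matching into a source. -/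
noncomputable def listPotential (k : ℕ) (L : List (Finset (Fin n))) : ℕ :=
  2 * (2 * ((listContent L).card + listNonInv L) + if ∃ L', ListMatch 0 L' L then 1 else 0) + k

theorem ListMatch.potential_lt {k : ℕ} {L L' : List (Finset (Fin n))} (h : ListMatch 0 L L') :
    listPotential (k + 1) L < listPotential k L' := by
  rw [listPotential, listPotential, if_neg fun ⟨_, h'⟩ => h.not_both h', if_pos ⟨_, h⟩,
    h.listContent_eq, h.listNonInv_eq]
  omega

theorem potential_lt_of_content_lt {k : ℕ} {L L' : List (Finset (Fin n))}
    (h : (listContent L').card < (listContent L).card) (h' : listNonInv L' ≤ listNonInv L) :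
    listPotential k L' < listPotential (k + 1) L := by
  rw [listPotential, listPotential]
  split_ifs <;> omega

theorem potential_lt_of_merge {k : ℕ} {σ τ : Finset (Fin n)} {l t : List (Finset (Fin n))}
    (hσ : σ.Nonempty) (hτ : τ.Nonempty) (hd : Disjoint σ τ)
    (h : ¬ ListMatch 0 (l ++ σ :: τ :: t) (l ++ (σ ∪ τ) :: t)) :
    listPotential k (l ++ (σ ∪ τ) :: t) < listPotential (k + 1) (l ++ σ :: τ :: t) := by
  have hc : listContent (l ++ (σ ∪ τ) :: t) = listContent (l ++ σ :: τ :: t) := by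
    simp [union_val_of_disjoint hd, add_assoc]
  rw [listPotential, listPotential, hc, listNonInv_merge hd]
  by_cases h0 : nonInv σ τ = 0
  · split_ifs with h1 h2
    · omega
    · obtain ⟨L, h1⟩ := h1
      exact absurd (ListMatch.of_merge hσ hτ h0 h1) (by tauto)
    · omega
    · omega
  · split_ifs <;> omega

end Potential

/-! ### The Morse matching -/

section Cells

variable {n : ℕ}

/-- The list `σ₁, …, σₖ` of a basis element of the normalized bar resolution. -/
def cellList {k : ℕ} (v : NCell n k) : List (Finset (Fin n)) := List.ofFn fun j => (v j).1

theorem nonempty_of_mem_cellList {k : ℕ} {v : NCell n k} {σ : Finset (Fin n)}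
    (h : σ ∈ cellList v) : σ.Nonempty := by
  obtain ⟨j, rfl⟩ := (List.mem_ofFn' _ _).1 h
  exact (v j).2

@[simp]
theorem length_cellList {k : ℕ} (v : NCell n k) : (cellList v).length = k := List.length_ofFn

theorem cellList_injective {k : ℕ} : Function.Injective (cellList (n := n) (k := k)) := by
  intro v w h
  funext j
  exact Subtype.ext (congrFun (List.ofFn_injective h) j)

theorem exists_cellList_eq {k : ℕ} {L : List (Finset (Fin n))} (hk : L.length = k)
    (h : ∀ σ ∈ L, σ.Nonempty) : ∃ v : NCell n k, cellList v = L := by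
  subst hk
  exact ⟨fun j => ⟨L[j], h _ (List.getElem_mem _)⟩, List.ofFn_getElem (xs := L)⟩

theorem barMatching_iff {k : ℕ} {v : NCell n (k + 1)} {w : NCell n k} :
    barMatching n k v w ↔ ListMatch 0 (cellList v) (cellList w) := by
  constructor
  · rintro ⟨l, i, σ, t, h1, h2, h3, h4⟩
    change cellList v = _ at h3
    change cellList w = _ at h4
    rw [h3, h4]
    refine ListMatch.of_pairwise h2 (nonempty_of_mem_cellList (v := v) ?_) h1 fun _ _ =>
      Nat.zero_le _
    rw [h3]
    simp
  · intro h
    obtain ⟨l, i, σ, t, h1, -, h2, -, h3, h4⟩ := h.exists_pairwise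
    exact ⟨l, i, σ, t, h1, h2, h3, h4⟩

theorem cellList_critCell {k : ℕ} (τ : Sym (Fin n) k) :
    cellList (critCell n k τ) = ((τ : Multiset (Fin n)).sort (· ≤ ·)).map fun a => {a} := by
  refine List.ext_getElem (by simp) fun j h1 h2 => ?_
  simp [cellList, critCell]

theorem listContent_critCell {k : ℕ} (τ : Sym (Fin n) k) :
    listContent (cellList (critCell n k τ)) = τ := by
  rw [cellList_critCell, listContent_map_singleton, Multiset.sort_eq]

theorem critCell_injective (k : ℕ) : Function.Injective (critCell n k) := by
  intro τ τ' h
  apply Subtype.ext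
  change (τ : Multiset (Fin n)) = τ'
  rw [← listContent_critCell τ, ← listContent_critCell τ', h]

theorem card_of_mem_critCell {k : ℕ} {τ : Sym (Fin n) k} {σ : Finset (Fin n)}
    (h : σ ∈ cellList (critCell n k τ)) : σ.card = 1 := by
  rw [cellList_critCell] at h
  obtain ⟨a, -, rfl⟩ := List.mem_map.1 h
  simp

theorem not_source_critCell {k : ℕ} (τ : Sym (Fin n) (k + 1)) (w : NCell n k) :
    ¬ barMatching n k (critCell n _ τ) w := fun h =>
  (barMatching_iff.1 h).not_source_of_pairwise
    (Multiset.pairwise_sort (τ : Multiset (Fin n)) (· ≤ ·))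
    (cellList_critCell τ)

theorem not_target_critCell {k : ℕ} (τ : Sym (Fin n) k) (v : NCell n (k + 1)) :
    ¬ barMatching n k v (critCell n _ τ) := fun h => by
  obtain ⟨σ, h1, h2⟩ := (barMatching_iff.1 h).not_target_singletons
  rw [card_of_mem_critCell h1] at h2
  exact h2.false

theorem eq_critCell_of_cellList {k : ℕ} {v : NCell n k} {l : List (Fin n)}
    (hl : l.Pairwise (· ≤ ·)) (h : cellList v = l.map fun a => {a}) :
    ∃ τ : Sym (Fin n) k, (τ : Multiset (Fin n)) = l ∧ v = critCell n k τ := by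
  have hk : l.length = k := by rw [← length_cellList v, h, List.length_map]
  refine ⟨⟨(l : Multiset (Fin n)), hk⟩, rfl, cellList_injective ?_⟩
  refine h.trans (Eq.trans ?_ (cellList_critCell _).symm)
  congr 1
  exact (List.Perm.eq_of_pairwise' hl (Multiset.pairwise_sort (l : Multiset (Fin n)) (· ≤ ·))
    (Multiset.coe_eq_coe.1 (Multiset.sort_eq (l : Multiset (Fin n)) _).symm))

theorem cell_trichotomy {k : ℕ} (v : NCell n k) :
    (∃ L', ListMatch 0 (cellList v) L') ∨ (∃ L', ListMatch 0 L' (cellList v)) ∨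
      ∃ τ, v = critCell n k τ := by
  rcases ListMatch.trichotomy (cellList v) 0 (fun σ hσ => nonempty_of_mem_cellList hσ)
    (fun σ hσ => by
      obtain ⟨a, ha⟩ := nonempty_of_mem_cellList (List.mem_of_mem_head? hσ)
      exact ⟨a, ha, Nat.zero_le _⟩) with h | h | ⟨l, h1, -, h2⟩
  · exact .inl h
  · exact .inr (.inl h)
  · obtain ⟨τ, -, h⟩ := eq_critCell_of_cellList h1 h2
    exact .inr (.inr ⟨τ, h⟩)

theorem exists_target {k : ℕ} {v : NCell n (k + 1)} {L' : List (Finset (Fin n))}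
    (h : ListMatch 0 (cellList v) L') : ∃ w : NCell n k, cellList w = L' ∧ barMatching n k v w := by
  obtain ⟨w, rfl⟩ := exists_cellList_eq (L := L') (k := k)
    (by have := h.length_eq; simp at this; omega)
    (h.nonempty_target fun σ hσ => nonempty_of_mem_cellList hσ)
  exact ⟨w, rfl, barMatching_iff.2 h⟩

theorem not_isMatched_iff {k : ℕ} (v : NCell n k) :
    ¬ IsMatched (barMatching n) v ↔ v ∈ Set.range (critCell n k) := by
  constructor
  · intro h
    rcases cell_trichotomy v with ⟨L', h'⟩ | ⟨L', h'⟩ | ⟨τ, h'⟩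
    · cases k with
      | zero =>
        have := h'.length_eq
        simp at this
      | succ k =>
        obtain ⟨w, -, hw⟩ := exists_target h'
        exact absurd (.source hw) h
    · obtain ⟨w, rfl⟩ := exists_cellList_eq (L := L') (k := k + 1) (by simp [h'.length_eq])
        (h'.nonempty_source fun σ hσ => nonempty_of_mem_cellList hσ)
      exact absurd (.target (barMatching_iff.2 h')) h
    · exact ⟨τ, h'.symm⟩
  · rintro ⟨τ, rfl⟩ h
    generalize hv : critCell n k τ = v at h
    cases h with
    | source h => subst hv; exact not_source_critCell τ _ h
    | target h => subst hv; exact not_target_critCell τ _ h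

end Cells

section Matching

variable {R : Type*} [CommRing R] {n : ℕ}

theorem tail_eq_iff {k : ℕ} {v : NCell n (k + 1)} {w : NCell n k} :
    (Fin.tail fun j => (v j).1) = (fun j => (w j).1) ↔ cellList v = (v 0).1 :: cellList w := by
  rw [cellList, List.ofFn_succ, List.cons.injEq, ← List.ofFn_injective.eq_iff]
  simp only [true_and]
  exact Iff.rfl

theorem init_eq_iff {k : ℕ} {v : NCell n (k + 1)} {w : NCell n k} :
    (Fin.init fun j => (v j).1) = (fun j => (w j).1) ↔
      cellList v = cellList w ++ [(v (Fin.last k)).1] := by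
  rw [cellList, List.ofFn_succ', List.concat_eq_append, List.append_left_inj,
    ← List.ofFn_injective.eq_iff]
  exact Iff.rfl

/-- The edges of the digraph remove the first or the last set, or merge two disjoint neighbours. -/
theorem nbarEntry_cases {k : ℕ} {v : NCell n (k + 1)} {w : NCell n k}
    (h : nbarEntry R n k v w ≠ 0) :
    (∃ σ, σ.Nonempty ∧ cellList v = σ :: cellList w) ∨
    (∃ σ, σ.Nonempty ∧ cellList v = cellList w ++ [σ]) ∨
    ∃ l σ τ t, σ.Nonempty ∧ τ.Nonempty ∧ Disjoint σ τ ∧ cellList v = l ++ σ :: τ :: t ∧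
      cellList w = l ++ (σ ∪ τ) :: t := by
  rw [nbarEntry, barEntry_eq, barFace_zero, barFace_last, Finset.sum_congr rfl fun i _ =>
    congrArg _ (barFace_middle k _ _ i)] at h
  by_contra hcon
  push Not at hcon
  obtain ⟨h1, h2, h3⟩ := hcon
  rw [if_neg fun h' => h1 _ (v 0).2 (tail_eq_iff.1 h'),
    if_neg fun h' => h2 _ (v (Fin.last k)).2 (init_eq_iff.1 h'), Finset.sum_eq_zero] at h
  · simp at h
  · intro i _
    rw [if_neg, smul_zero]
    rintro ⟨hd, hw⟩
    obtain ⟨l, t, -, h4, h5⟩ := ofFn_contractNth (· ∪ ·) (fun j => (v j).1) i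
    rw [hw] at h5
    exact h3 l _ _ t (v i.castSucc).2 (v i.succ).2 hd h4 h5

theorem potential_lt_of_entry {k : ℕ} {v : NCell n (k + 1)} {w : NCell n k}
    (h : nbarEntry R n k v w ≠ 0) (hM : ¬ barMatching n k v w) :
    listPotential k (cellList w) < listPotential (k + 1) (cellList v) := by
  rcases nbarEntry_cases h with ⟨σ, hσ, h1⟩ | ⟨σ, hσ, h1⟩ | ⟨l, σ, τ, t, hσ, hτ, hd, h1, h2⟩
  · rw [h1]
    refine potential_lt_of_content_lt ?_ (Nat.le_add_left _ _)
    have := hσ.card_pos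
    simpa
  · rw [h1]
    refine potential_lt_of_content_lt ?_ (listNonInv_append_singleton _ _)
    have := hσ.card_pos
    simpa
  · rw [barMatching_iff, h1, h2] at hM
    rw [h1, h2]
    exact potential_lt_of_merge hσ hτ hd hM

/-- The entry of the differential at a merge. -/
theorem nbarEntry_merge {k : ℕ} {v : NCell n (k + 1)} {w : NCell n k} {l t : List (Finset (Fin n))}
    {σ τ : Finset (Fin n)} (hd : Disjoint σ τ) (hv : cellList v = l ++ σ :: τ :: t)
    (hw : cellList w = l ++ (σ ∪ τ) :: t) :
    nbarEntry R n k v w = algebraMap R _ ((-1) ^ (l.length + 1) *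
      (extBasis R n).repr (extBasis R n σ * extBasis R n τ) (σ ∪ τ)) := by
  have hc : (listContent (cellList v)).card = (listContent (cellList w)).card := by
    simp only [hv, hw, listContent_append, listContent_cons, union_val_of_disjoint hd, add_assoc]
  rw [nbarEntry, barEntry_eq, barFace_zero, barFace_last, if_neg, if_neg]
  · obtain ⟨j, hj, rfl, rfl, hw'⟩ := eq_contractNth_of_ofFn (· ∪ ·) hv hw
    rw [Fintype.sum_eq_single j, barFace_middle, if_pos ⟨hd, hw'.symm⟩, hj]
    · rw [RingHom.map_mul, smul_zero, add_zero, zero_add]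
      exact Algebra.smul_def ((-1 : R) ^ (l.length + 1)) (algebraMap R (Env R (ExtAlg R n)) _)
    · intro i hij
      rw [barFace_middle, if_neg, smul_zero]
      rintro ⟨hdi, hi⟩
      have heq := hi.trans hw'
      -- Two different merges with equal result force the sets merged first to overlap.
      have key : ∀ i j : Fin k, i < j → i.castSucc.contractNth (· ∪ ·) (fun j => (v j).1) =
          j.castSucc.contractNth (· ∪ ·) (fun j => (v j).1) →
          ¬ Disjoint (v i.castSucc).1 (v i.succ).1 := by
        intro i j hij heq hd
        have h1 := congrFun heq i
        rw [Fin.contractNth_apply_of_eq _ _ _ _ (by simp),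
          Fin.contractNth_apply_of_lt _ _ _ _ (by simpa using hij)] at h1
        obtain ⟨a, ha⟩ := (v i.succ).2
        have h2 : a ∈ (v i.castSucc).1 := by
          rw [← h1]
          exact Finset.mem_union_right _ ha
        exact Finset.disjoint_left.1 hd h2 ha
      rcases lt_or_gt_of_ne hij with h | h
      · exact key i j h heq hdi
      · exact key j i h heq.symm hd
  · intro h
    rw [init_eq_iff] at h
    have := (v (Fin.last k)).2.card_pos
    rw [h] at hc
    simp only [listContent_append, listContent_cons, listContent_nil, Multiset.card_add,
      Finset.card_val, Multiset.card_zero] at hc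
    omega
  · intro h
    rw [tail_eq_iff] at h
    have := (v 0).2.card_pos
    rw [h] at hc
    simp only [listContent_cons, Multiset.card_add, Finset.card_val] at hc
    omega

theorem isUnit_repr_mul {σ τ : Finset (Fin n)} (hd : Disjoint σ τ) :
    IsUnit ((extBasis R n).repr (extBasis R n σ * extBasis R n τ) (σ ∪ τ)) := by
  obtain ⟨s, hs⟩ := extBasis_mul_of_disjoint R hd
  rw [hs]
  rcases Int.units_eq_one_or s with rfl | rfl <;> simp

theorem barMatching_isUnit {k : ℕ} {v : NCell n (k + 1)} {w : NCell n k}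
    (h : barMatching n k v w) : IsUnit (nbarEntry R n k v w) := by
  obtain ⟨l, i, σ, t, -, hi, h1, h2⟩ := h
  have hu : ({i} : Finset (Fin n)) ∪ σ.erase i = σ := by
    rw [← Finset.insert_eq, Finset.insert_erase hi.1]
  have hd : Disjoint ({i} : Finset (Fin n)) (σ.erase i) := by simp
  rw [nbarEntry_merge hd h1 (by rw [hu]; exact h2)]
  exact (((isUnit_one.neg).pow _).mul (isUnit_repr_mul hd)).map _

/-- The potential of a vertex of the digraph. -/
noncomputable def vertexPotential (a : MorseVertex (nbarEntry R n) (barMatching n)) : ℕ :=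
  listPotential a.deg (cellList a.cell)

theorem vertexPotential_lt : ∀ {a b : MorseVertex (nbarEntry R n) (barMatching n)},
    (a ⟶ b) → vertexPotential b < vertexPotential a
  | _, _, .down _ _ _ hW hM => potential_lt_of_entry hW hM
  | _, _, .up _ _ _ hM => (barMatching_iff.1 hM).potential_lt

theorem vertexPotential_add_length_le {a b : MorseVertex (nbarEntry R n) (barMatching n)}
    (p : Quiver.Path a b) : vertexPotential b + p.length ≤ vertexPotential a := by
  induction p with
  | nil => simp
  | cons p e ih =>
    have := vertexPotential_lt e
    rw [Quiver.Path.length_cons]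
    omega

variable (R n) in
theorem isMorseMatching_barMatching : IsMorseMatching (nbarEntry R n) (barMatching n) where
  isUnit _ _ _ h := barMatching_isUnit h
  target_unique _ _ _ _ h h' :=
    cellList_injective ((barMatching_iff.1 h).target_unique (barMatching_iff.1 h'))
  source_unique _ _ _ _ h h' :=
    cellList_injective ((barMatching_iff.1 h).source_unique (barMatching_iff.1 h'))
  not_both _ _ _ _ h h' := (barMatching_iff.1 h').not_both (barMatching_iff.1 h)
  acyclic a p := by
    have := vertexPotential_add_length_le p
    omega
  no_infinite k := by
    rintro ⟨f, hf, -⟩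
    have h : ∀ m, vertexPotential (f (m + 1)) < vertexPotential (f m) := fun m =>
      vertexPotential_lt (hf m).some
    exact not_strictAnti_of_wellFoundedLT (fun m => vertexPotential (f m))
      (strictAnti_nat_of_succ_lt h)

end Matching

/-! ### Paths between critical cells -/

section Content

variable {n : ℕ}

theorem length_le_card_listContent : ∀ {L : List (Finset (Fin n))}, (∀ σ ∈ L, σ.Nonempty) →
    L.length ≤ (listContent L).card
  | [], _ => by simp
  | σ :: L, h => by
    have h1 := length_le_card_listContent fun ρ hρ => h ρ (List.mem_cons_of_mem σ hρ)
    have h2 := (h σ (by simp)).card_pos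
    simp only [List.length_cons, listContent_cons, Multiset.card_add, Finset.card_val]
    omega

theorem card_eq_one_of_length_eq : ∀ {L : List (Finset (Fin n))}, (∀ σ ∈ L, σ.Nonempty) →
    (listContent L).card = L.length → ∀ σ ∈ L, σ.card = 1
  | [], _, _ => by simp
  | σ :: L, h, hc => by
    have h0 : ∀ ρ ∈ L, ρ.Nonempty := fun ρ hρ => h ρ (List.mem_cons_of_mem σ hρ)
    have h1 := length_le_card_listContent h0
    have h2 := (h σ (by simp)).card_pos
    simp only [List.length_cons, listContent_cons, Multiset.card_add, Finset.card_val] at hc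
    have h3 := card_eq_one_of_length_eq h0 (by omega)
    intro ρ hρ
    rcases List.mem_cons.1 hρ with rfl | hρ
    · omega
    · exact h3 ρ hρ

/-- A list of singletons with given merge `l, {i, m}, t` is `l, {i}, {m}, t` or `l, {m}, {i}, t`. -/
theorem eq_swap_of_merge {l t l₁ t₁ : List (Finset (Fin n))} {i m : Fin n} {σ τ : Finset (Fin n)}
    (h₁ : ∀ ρ ∈ l₁ ++ σ :: τ :: t₁, ρ.card = 1) (hd : Disjoint σ τ)
    (h : ∀ ρ ∈ l ++ {i} :: {m} :: t, ρ.card = 1)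
    (heq : l₁ ++ (σ ∪ τ) :: t₁ = l ++ ({i} ∪ {m}) :: t)
    (hne : l₁ ++ σ :: τ :: t₁ ≠ l ++ {i} :: {m} :: t) :
    l₁ ++ σ :: τ :: t₁ = l ++ {m} :: {i} :: t := by
  have hσ : σ.card = 1 := h₁ σ (by simp)
  have hτ : τ.card = 1 := h₁ τ (by simp)
  have hu : (σ ∪ τ).card = 2 := by rw [Finset.card_union_of_disjoint hd, hσ, hτ]
  have hl : σ ∪ τ ∉ l := fun h' => by
    have := h _ (List.mem_append_left _ h')
    omega
  have ht : σ ∪ τ ∉ t := fun h' => by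
    have := h _ (List.mem_append_right _ (List.mem_cons_of_mem _ (List.mem_cons_of_mem _ h')))
    omega
  obtain ⟨rfl, h2, rfl⟩ := (List.append_cons_inj_of_notMem hl ht).1 heq.symm
  obtain ⟨x, rfl⟩ := Finset.card_eq_one.1 hσ
  obtain ⟨y, rfl⟩ := Finset.card_eq_one.1 hτ
  have hxy : x ≠ y := by simpa using hd
  have hx : x = i ∨ x = m := by
    have : x ∈ ({i} ∪ {m} : Finset (Fin n)) := by rw [h2]; simp
    simpa using this
  have hy : y = i ∨ y = m := by
    have : y ∈ ({i} ∪ {m} : Finset (Fin n)) := by rw [h2]; simp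
    simpa using this
  rcases hx with rfl | rfl <;> rcases hy with rfl | rfl
  · exact absurd rfl hxy
  · exact absurd rfl hne
  · rfl
  · exact absurd rfl hxy

end Content

section Paths

variable {R : Type*} [CommRing R] {n : ℕ}

variable (R) in
/-- The unmatched vertex `x_(τ)` of the digraph. -/
abbrev critVertex {k : ℕ} (τ : Sym (Fin n) k) : MorseVertex (nbarEntry R n) (barMatching n) :=
  ⟨k, critCell n k τ⟩

theorem listContent_le_of_edge : ∀ {a b : MorseVertex (nbarEntry R n) (barMatching n)},
    (a ⟶ b) → listContent (cellList b.cell) ≤ listContent (cellList a.cell)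
  | _, _, .down k v w hW hM => by
    rcases nbarEntry_cases hW with ⟨σ, -, h⟩ | ⟨σ, -, h⟩ | ⟨l, σ, τ, t, -, -, hd, h1, h2⟩
    · simp [h]
    · simp [h]
    · refine le_of_eq ?_
      simp only [h1, h2, listContent_append, listContent_cons, union_val_of_disjoint hd, add_assoc]
  | _, _, .up _ _ _ hM => (barMatching_iff.1 hM).listContent_eq.le

theorem listContent_le_of_path {a b : MorseVertex (nbarEntry R n) (barMatching n)}
    (p : Quiver.Path a b) : listContent (cellList b.cell) ≤ listContent (cellList a.cell) := by
  induction p with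
  | nil => exact le_rfl
  | cons _ e ih => exact (listContent_le_of_edge e).trans ih

theorem deg_le_of_path {k : ℕ} {τ : Sym (Fin n) k}
    {b : MorseVertex (nbarEntry R n) (barMatching n)} (p : Quiver.Path (critVertex R τ) b) :
    b.deg ≤ k := by
  have h1 := Multiset.card_le_card (listContent_le_of_path p)
  rw [listContent_critCell] at h1
  have h2 := length_le_card_listContent (L := cellList b.cell)
    fun σ hσ => nonempty_of_mem_cellList hσ
  rw [length_cellList] at h2
  exact h2.trans (h1.trans τ.2.le)

/-- A vertex of maximal degree that can be reached from `x_(τ)` is a word in the letters of `τ`. -/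
theorem content_eq_of_path {k : ℕ} {τ : Sym (Fin n) k} {v : NCell n k}
    (p : Quiver.Path (critVertex R τ) ⟨k, v⟩) : listContent (cellList v) = τ := by
  have h1 := listContent_le_of_path p
  rw [listContent_critCell] at h1
  refine Multiset.eq_of_le_of_card_le h1 ?_
  have h2 := length_le_card_listContent (L := cellList v) fun σ hσ => nonempty_of_mem_cellList hσ
  rw [length_cellList] at h2
  exact τ.2.le.trans h2

theorem card_eq_one_of_content {k : ℕ} {τ : Sym (Fin n) k} {v : NCell n k}
    (h : listContent (cellList v) = τ) : ∀ σ ∈ cellList v, σ.card = 1 := by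
  refine card_eq_one_of_length_eq (fun σ hσ => nonempty_of_mem_cellList hσ) ?_
  rw [h, length_cellList]
  exact τ.2

/-- A nontrivial path ends with an edge of the differential or with a reversed edge. -/
theorem cons_cases {a : MorseVertex (nbarEntry R n) (barMatching n)} :
    ∀ {c b : MorseVertex (nbarEntry R n) (barMatching n)} (e : c ⟶ b) (p : Quiver.Path a c),
    (∃ (v : NCell n (b.deg + 1)) (hW : nbarEntry R n b.deg v b.cell ≠ 0)
      (hM : ¬ barMatching n b.deg v b.cell) (p' : Quiver.Path a ⟨b.deg + 1, v⟩),
      p.cons e = p'.cons (MorseEdge.down b.deg v b.cell hW hM)) ∨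
    ∃ (k : ℕ) (v : NCell n (k + 1)) (w : NCell n k) (hM : barMatching n k v w)
      (p' : Quiver.Path a ⟨k, w⟩) (_ : b = ⟨k + 1, v⟩),
      p.cons e ≍ p'.cons (MorseEdge.up (W := nbarEntry R n) k v w hM)
  | _, _, .down _ v _ hW hM, p => .inl ⟨v, hW, hM, p, rfl⟩
  | _, _, .up _ _ _ hM, p => .inr ⟨_, _, _, hM, p, rfl, HEq.rfl⟩

/-- A path that ends one degree below its critical start ends with an edge of the differential
unless its end is the target of a reversed edge. -/
theorem path_cases_below {k : ℕ} {τ : Sym (Fin n) (k + 1)} {w : NCell n k}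
    (p : Quiver.Path (critVertex R τ) ⟨k, w⟩) (hw : ∀ L', ¬ ListMatch 0 (cellList w) L') :
    ∃ (v : NCell n (k + 1)) (hW : nbarEntry R n k v w ≠ 0) (hM : ¬ barMatching n k v w)
      (p' : Quiver.Path (critVertex R τ) ⟨k + 1, v⟩),
      p = p'.cons (MorseEdge.down k v w hW hM) := by
  cases p with
  | cons p e =>
    rcases cons_cases e p with h | ⟨_, _, _, hM, _, h, -⟩
    · exact h
    · cases h
      exact absurd (barMatching_iff.1 hM) (hw _)

/-- A nontrivial path that ends in the degree of its critical start ends with a reversed edge. -/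
theorem path_cases_top {k : ℕ} {τ : Sym (Fin n) (k + 1)} {v : NCell n (k + 1)}
    (p : Quiver.Path (critVertex R τ) ⟨k + 1, v⟩) :
    (v = critCell n _ τ ∧ p.length = 0) ∨
    ∃ (w : NCell n k) (hM : barMatching n k v w) (p' : Quiver.Path (critVertex R τ) ⟨k, w⟩),
      p = p'.cons (MorseEdge.up k v w hM) := by
  cases p with
  | nil => exact .inl ⟨rfl, rfl⟩
  | cons p e =>
    rcases cons_cases e p with ⟨_, _, _, p', -⟩ | ⟨_, _, _, hM, p', h, hp⟩
    · exact absurd (deg_le_of_path p') (Nat.not_succ_le_self _)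
    · cases h
      exact .inr ⟨_, hM, p', eq_of_heq hp⟩

theorem path_eq_of_length_eq_zero {V : Type*} [Quiver V] {a b : V} :
    ∀ {p q : Quiver.Path a b}, p.length = 0 → q.length = 0 → p = q
  | .nil, .nil, _, _ => rfl

/-- A word is reached from `x_(τ)` along at most one path: the last reversed edge of a path is
the matching edge at the first descent of the word, and the edge before it undoes this descent. -/
theorem path_unique {k : ℕ} {τ : Sym (Fin n) (k + 1)} (N : ℕ) :
    ∀ {v : NCell n (k + 1)} (p q : Quiver.Path (critVertex R τ) ⟨k + 1, v⟩), p.length < N →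
      p = q := by
  induction N with
  | zero => intro _ _ _ h; omega
  | succ N ih =>
    intro v p q hN
    rcases path_cases_top p with ⟨hv, hp⟩ | ⟨w, hM, p', rfl⟩ <;>
      rcases path_cases_top q with ⟨hv', hq⟩ | ⟨w', hM', q', rfl⟩
    · exact path_eq_of_length_eq_zero hp hq
    · subst hv
      exact absurd hM' (not_source_critCell τ _)
    · subst hv'
      exact absurd hM (not_source_critCell τ _)
    · obtain rfl : w = w' := (isMorseMatching_barMatching R n).target_unique _ _ _ _ hM hM'
      have hns : ∀ L', ¬ ListMatch 0 (cellList w) L' := fun L' h =>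
        h.not_both (barMatching_iff.1 hM)
      have hcv := content_eq_of_path (p'.cons (MorseEdge.up k v w hM))
      have hcw : listContent (cellList w) = τ := by
        rw [← (barMatching_iff.1 hM).listContent_eq, hcv]
      obtain ⟨l, i, σ, t, -, -, hi, -, h1, h2⟩ := (barMatching_iff.1 hM).exists_pairwise
      obtain ⟨m, hm⟩ : ∃ m, σ.erase i = {m} := Finset.card_eq_one.1
        (card_eq_one_of_content hcv _ (by rw [h1]; simp))
      have hu : ({i} : Finset (Fin n)) ∪ {m} = σ := by
        rw [← hm, ← Finset.insert_eq, Finset.insert_erase hi.1]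
      rw [hm] at h1
      -- The last edge of the differential in `p` starts in `v` with `i` and `m` interchanged.
      have key : ∀ {v' : NCell n (k + 1)} (_ : Quiver.Path (critVertex R τ) ⟨k + 1, v'⟩),
          nbarEntry R n k v' w ≠ 0 → ¬ barMatching n k v' w →
          cellList v' = l.map (fun a => {a}) ++ {m} :: {i} :: t := by
        intro v' r hW hM'
        have hcv' := content_eq_of_path r
        rcases nbarEntry_cases hW with ⟨ρ, hρ, h3⟩ | ⟨ρ, hρ, h3⟩ | ⟨l₁, ρ, ρ', t₁, -, -, hd, h3, h4⟩
        · rw [h3, listContent_cons, hcw] at hcv'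
          simp at hcv'
          simp [hcv'] at hρ
        · rw [h3, listContent_append, hcw] at hcv'
          simp at hcv'
          simp [hcv'] at hρ
        · rw [h3]
          refine eq_swap_of_merge ?_ hd ?_ ?_ ?_
          · rw [← h3]; exact card_eq_one_of_content hcv'
          · rw [← h1]; exact card_eq_one_of_content hcv
          · rw [hu, ← h2, h4]
          · rw [← h3, ← h1]
            intro h5
            rw [cellList_injective h5] at hM'
            exact hM' hM
      obtain ⟨v₁, hW₁, hM₁, p₁, rfl⟩ := path_cases_below p' hns
      obtain ⟨v₂, hW₂, hM₂, q₁, rfl⟩ := path_cases_below q' hns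
      obtain rfl : v₁ = v₂ := cellList_injective ((key p₁ hW₁ hM₁).trans (key q₁ hW₂ hM₂).symm)
      rw [ih p₁ q₁ (by simp only [Quiver.Path.length_cons] at hN; omega)]

instance path_subsingleton {k : ℕ} (τ : Sym (Fin n) (k + 1)) (v : NCell n (k + 1)) :
    Subsingleton (Quiver.Path (critVertex R τ) ⟨k + 1, v⟩) :=
  ⟨fun p q => path_unique _ p q (Nat.lt_succ_self _)⟩

theorem mul_neg_inverse_neg {S : Type*} [Ring S] {x : S} (h : x * x = 1) :
    x * -Ring.inverse (-x) = 1 := by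
  have : Ring.inverse (-x) = -x :=
    Ring.inverse_unit ⟨-x, -x, by rw [neg_mul_neg, h], by rw [neg_mul_neg, h]⟩
  rw [this, neg_neg, h]

/-- Every word in the letters of `τ` is reached from `x_(τ)` by sorting it backwards, one
descent at a time, and the two edges of each step have weight `± 1` of equal sign. -/
theorem exists_path_weight_eq_one [Nontrivial R] {k : ℕ} {τ : Sym (Fin n) (k + 1)}
    (v : NCell n (k + 1)) (hv : listContent (cellList v) = τ) :
    ∃ p : Quiver.Path (critVertex R τ) ⟨k + 1, v⟩,
      p.weight (fun {_ _} e => MorseEdge.weight (nbarEntry R n) (barMatching n) e) = 1 := by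
  have hne : Nontrivial (Env R (ExtAlg R n)) :=
    nontrivial_of_ne _ _ ((envBasis R n).ne_zero (∅, ∅))
  have hwf : WellFounded fun v v' : NCell n (k + 1) =>
      listPotential (k + 1) (cellList v') < listPotential (k + 1) (cellList v) :=
    @Finite.wellFounded_of_trans_of_irrefl _ _ _ ⟨fun _ _ _ h h' => lt_trans h' h⟩
      ⟨fun _ => lt_irrefl _⟩
  induction v using hwf.induction with
  | _ v ih =>
    have hone := card_eq_one_of_content hv
    rcases cell_trichotomy v with ⟨L', h⟩ | ⟨L', h⟩ | ⟨τ', rfl⟩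
    · obtain ⟨w, rfl, hM⟩ := exists_target h
      obtain ⟨l, i, σ, t, -, -, hi, -, h1, h2⟩ := h.exists_pairwise
      obtain ⟨m, hm⟩ : ∃ m, σ.erase i = {m} := Finset.card_eq_one.1
        (hone _ (by rw [h1]; simp))
      have hmi : m < i := ListMatch.lt_of_mem_erase hi (by simp [hm])
      have hu : ({i} : Finset (Fin n)) ∪ {m} = σ := by
        rw [← hm, ← Finset.insert_eq, Finset.insert_erase hi.1]
      rw [hm] at h1
      rw [← hu] at h2
      obtain ⟨v', hv'⟩ := exists_cellList_eq (k := k + 1)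
        (L := l.map (fun a => {a}) ++ {m} :: {i} :: t)
        (by rw [← length_cellList v, h1]; simp) (by
          have := fun σ (hσ : σ ∈ cellList v) => nonempty_of_mem_cellList hσ
          rw [h1] at this
          intro ρ hρ
          apply this
          simp only [List.mem_append, List.mem_cons] at hρ ⊢
          tauto)
      have hW : nbarEntry R n k v w = -algebraMap R _ ((-1) ^ (l.length + 1)) := by
        rw [nbarEntry_merge (by simpa using hmi.ne') h1 h2, extBasis_singleton, extBasis_singleton,
          extX_anticomm, ← extBasis_singleton R m, extBasis_mul_extX R (by simpa using hmi)]
        rw [← Finset.insert_eq, map_neg, Finsupp.neg_apply, Module.Basis.repr_self,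
          Finsupp.single_eq_same, mul_neg, mul_one, List.length_map]
        exact map_neg (algebraMap R (Env R (ExtAlg R n))) _
      have hW' : nbarEntry R n k v' w = algebraMap R _ ((-1) ^ (l.length + 1)) := by
        rw [Finset.union_comm] at h2
        rw [nbarEntry_merge (by simpa using hmi.ne) hv' h2, extBasis_singleton R i,
          extBasis_mul_extX R (by simpa using hmi)]
        rw [Finset.union_comm, ← Finset.insert_eq, Module.Basis.repr_self,
          Finsupp.single_eq_same, mul_one, List.length_map]
      have hsq : (algebraMap R (Env R (ExtAlg R n)) ((-1) ^ (l.length + 1))) *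
          algebraMap R _ ((-1) ^ (l.length + 1)) = 1 := by
        rw [← RingHom.map_mul, ← mul_pow, neg_one_mul, neg_neg, one_pow, RingHom.map_one]
      have hW0 : nbarEntry R n k v' w ≠ 0 := by
        intro h0
        rw [← hW', h0, zero_mul] at hsq
        exact zero_ne_one hsq
      have hM' : ¬ barMatching n k v' w := by
        intro hM'
        have := (isMorseMatching_barMatching R n).source_unique _ _ _ _ hM hM'
        rw [this, hv'] at h1
        simp [hmi.ne] at h1
      obtain ⟨p, hp⟩ := ih v' (h.potential_lt.trans (potential_lt_of_entry hW0 hM')) (by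
        rw [← hv, h1, hv']
        simp [Multiset.cons_swap])
      refine ⟨(p.cons (MorseEdge.down k v' w hW0 hM')).cons (MorseEdge.up k v w hM), ?_⟩
      rw [Quiver.Path.weight_cons, Quiver.Path.weight_cons, hp, one_mul]
      change nbarEntry R n k v' w * -Ring.inverse (nbarEntry R n k v w) = 1
      rw [hW, hW']
      exact mul_neg_inverse_neg hsq
    · obtain ⟨σ, h1, h2⟩ := h.not_target_singletons
      rw [hone σ h1] at h2
      exact absurd h2 (lt_irrefl _)
    · rw [listContent_critCell] at hv
      obtain rfl : τ' = τ := Subtype.ext hv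
      exact ⟨.nil, Quiver.Path.weight_nil _ _⟩

end Paths

/-! ### The differential as a sum over paths -/

section PathSum

variable {R : Type*} [CommRing R] {n : ℕ}

theorem not_listMatch_critCell {k : ℕ} (τ : Sym (Fin n) k) (L : List (Finset (Fin n))) :
    ¬ ListMatch 0 (cellList (critCell n k τ)) L := fun h =>
  h.not_source_of_pairwise (Multiset.pairwise_sort (τ : Multiset (Fin n)) (· ≤ ·))
    (cellList_critCell τ)

/-- A path from `x_(τ)` to `x_(τ')` is determined by the source of its last edge. This source is a
word in the letters of `τ`, and the weight of the path is the weight of its last edge. -/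
theorem exists_path_source {k : ℕ} (τ : Sym (Fin n) (k + 1)) (τ' : Sym (Fin n) k) :
    ∃ s : Quiver.Path (critVertex R τ) (critVertex R τ') → NCell n (k + 1),
      Function.Injective s ∧ (∀ p, listContent (cellList (s p)) = τ) ∧
      (Nontrivial R → ∀ p, p.weight (fun {_ _} e => MorseEdge.weight _ _ e) =
        nbarEntry R n k (s p) (critCell n k τ')) ∧
      (Nontrivial R → ∀ v, listContent (cellList v) = τ →
        nbarEntry R n k v (critCell n k τ') ≠ 0 → v ∈ Set.range s) := by
  choose s hW hM p' hp using fun p : Quiver.Path (critVertex R τ) (critVertex R τ') =>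
    path_cases_below p (not_listMatch_critCell τ')
  refine ⟨s, fun p q h => ?_, fun p => content_eq_of_path (p' p), fun hR p => ?_,
    fun hR v hv hW' => ?_⟩
  · have key : ∀ {v v' : NCell n (k + 1)} (_ : v = v') (hW hM hW' hM')
        (r : Quiver.Path (critVertex R τ) ⟨k + 1, v⟩)
        (r' : Quiver.Path (critVertex R τ) ⟨k + 1, v'⟩),
        r.cons (MorseEdge.down k v (critCell n k τ') hW hM) =
          r'.cons (MorseEdge.down k v' (critCell n k τ') hW' hM') := by
      rintro v _ rfl _ _ _ _ r r'
      rw [Subsingleton.elim r r']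
    rw [hp p, hp q]
    exact key h _ _ _ _ _ _
  · obtain ⟨r, hr⟩ := exists_path_weight_eq_one (R := R) (s p) (content_eq_of_path (p' p))
    obtain rfl := Subsingleton.elim r (p' p)
    conv_lhs => rw [hp p]
    rw [Quiver.Path.weight_cons, hr, one_mul]
    rfl
  · obtain ⟨r, -⟩ := exists_path_weight_eq_one (R := R) v hv
    refine ⟨r.cons (MorseEdge.down k v _ hW' (not_target_critCell τ' v)), ?_⟩
    have h := Quiver.Path.obj_eq_of_cons_eq_cons
      (hp (r.cons (MorseEdge.down k v _ hW' (not_target_critCell τ' v))))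
    simpa using h.symm

theorem finite_path {k : ℕ} (τ : Sym (Fin n) (k + 1)) (τ' : Sym (Fin n) k) :
    Finite (Quiver.Path (critVertex R τ) (critVertex R τ')) :=
  let ⟨_, hs, _⟩ := exists_path_source (R := R) τ τ'
  Finite.of_injective _ hs

theorem pathSum_eq_sum [Nontrivial R] {k : ℕ} (τ : Sym (Fin n) (k + 1)) (τ' : Sym (Fin n) k) :
    pathSum (nbarEntry R n) (barMatching n) (critVertex R τ) (critVertex R τ') =
      ∑ v : NCell n (k + 1), if listContent (cellList v) = τ then
        nbarEntry R n k v (critCell n k τ') else 0 := by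
  obtain ⟨s, hs, h1, h2, h3⟩ := exists_path_source (R := R) τ τ'
  have := finite_path (R := R) τ τ'
  have := Fintype.ofFinite (Quiver.Path (critVertex R τ) (critVertex R τ'))
  rw [pathSum, finsum_eq_sum_of_fintype]
  refine Finset.sum_of_injOn s hs.injOn (fun _ _ => Finset.mem_coe.2 (Finset.mem_univ _))
    (fun v _ hv => ?_) fun p _ => ?_
  · split_ifs with hc
    · by_contra h0
      obtain ⟨p, hp⟩ := h3 ‹_› v hc h0
      exact hv ⟨p, by simp, hp⟩
    · rfl
  · rw [if_pos (h1 p), h2 ‹_› p]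

/-- An edge of the differential that ends in a word removes the first or the last set. -/
theorem nbarEntry_critCell {k : ℕ} (v : NCell n (k + 1)) (τ' : Sym (Fin n) k) :
    nbarEntry R n k v (critCell n k τ') =
      barFace R (fun j => (v j).1) (fun j => (critCell n k τ' j).1) 0 +
      (-1 : R) ^ (k + 1) •
        barFace R (fun j => (v j).1) (fun j => (critCell n k τ' j).1) (Fin.last _) := by
  rw [nbarEntry, barEntry_eq, Finset.sum_eq_zero, zero_add]
  intro i _
  rw [barFace_middle, if_neg, smul_zero]
  rintro ⟨hd, hw⟩
  have h1 : ((v i.castSucc).1 ∪ (v i.succ).1).card = 1 := by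
    refine card_of_mem_critCell (τ := τ') ?_
    have h2 := congrFun hw i
    rw [Fin.contractNth_apply_of_eq _ _ _ _ (by simp)] at h2
    rw [h2]
    exact (List.mem_ofFn' _ _).2 ⟨i, rfl⟩
  rw [Finset.card_union_of_disjoint hd] at h1
  have h2 := (v i.castSucc).2.card_pos
  have h3 := (v i.succ).2.card_pos
  omega

/-- If `F` is supported on words `e i` that consist of `τ'` and one more letter `i`, the sum of
`F` over the words in the letters of `τ` runs over the `i` with `τ = τ' ∪ {i}`. -/
theorem sum_words_eq {E : Type*} [AddCommMonoid E] {k : ℕ} (τ : Sym (Fin n) (k + 1))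
    (τ' : Sym (Fin n) k) (F : NCell n (k + 1) → E) (e : Fin n → NCell n (k + 1))
    (he : Function.Injective e) (hc : ∀ i, listContent (cellList (e i)) = i ::ₘ (τ' : Multiset _))
    (hF : ∀ v, listContent (cellList v) = τ → F v ≠ 0 → ∃ i, v = e i) :
    (∑ v, if listContent (cellList v) = τ then F v else 0) =
      ∑ i, if τ = i ::ₛ τ' then F (e i) else 0 := by
  refine (Finset.sum_of_injOn e he.injOn (fun _ _ => Finset.mem_coe.2 (Finset.mem_univ _))
    (fun v _ hv => ?_) fun i _ => ?_).symm
  · split_ifs with h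
    · by_contra h0
      obtain ⟨i, rfl⟩ := hF v h h0
      exact hv ⟨i, by simp, rfl⟩
    · rfl
  · refine if_congr ?_ rfl rfl
    rw [hc, ← Sym.coe_cons, Sym.coe_inj, eq_comm]

theorem mresD_single_eq_sum {k : ℕ} (τ : Sym (Fin n) (k + 1)) (τ' : Sym (Fin n) k) :
    mresD R n k (Finsupp.single τ 1) τ' =
      ∑ v : NCell n (k + 1), if listContent (cellList v) = τ then
        nbarEntry R n k v (critCell n k τ') else 0 := by
  have hw : ∀ σ ∈ cellList (critCell n k τ'), σ.Nonempty := fun σ => nonempty_of_mem_cellList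
  choose c hc using fun i : Fin n => exists_cellList_eq (k := k + 1)
    (L := {i} :: cellList (critCell n k τ')) (by simp) (by simpa using hw)
  choose d hd using fun i : Fin n => exists_cellList_eq (k := k + 1)
    (L := cellList (critCell n k τ') ++ [{i}]) (by simp) (by
      simp only [List.mem_append, List.mem_singleton]
      rintro σ (h | rfl)
      · exact hw σ h
      · exact Finset.singleton_nonempty i)
  have hc0 (i : Fin n) : (c i 0).1 = {i} := by
    have := hc i
    rw [cellList, List.ofFn_succ, List.cons.injEq] at this
    exact this.1
  have hdl (i : Fin n) : (d i (Fin.last k)).1 = {i} := by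
    have := hd i
    rw [cellList, List.ofFn_succ', List.concat_eq_append] at this
    simpa using (List.append_inj' this rfl).2
  have h1 := sum_words_eq τ τ'
    (fun v => barFace R (fun j => (v j).1) (fun j => (critCell n k τ' j).1) 0) c
    (fun i j h => by
      have := hc0 i
      rw [h, hc0 j] at this
      simpa using this.symm)
    (fun i => by rw [hc, listContent_cons, listContent_critCell]; rfl) (fun v hv h0 => by
      rw [barFace_zero] at h0
      have h2 := tail_eq_iff.1 (ite_ne_right_iff.1 h0).1
      obtain ⟨i, hi⟩ := Finset.card_eq_one.1
        (card_eq_one_of_content hv (v 0).1 (by rw [h2]; simp))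
      exact ⟨i, cellList_injective (by rw [h2, hi, hc])⟩)
  have h2 := sum_words_eq τ τ' (fun v => (-1 : R) ^ (k + 1) •
      barFace R (fun j => (v j).1) (fun j => (critCell n k τ' j).1) (Fin.last _)) d
    (fun i j h => by
      have := hdl i
      rw [h, hdl j] at this
      simpa using this.symm)
    (fun i => by
      rw [hd, listContent_append, listContent_cons, listContent_critCell]
      simp [add_comm]) (fun v hv h0 => by
      rw [barFace_last] at h0
      have h2 := init_eq_iff.1 (ite_ne_right_iff.1 (right_ne_zero_of_smul h0)).1
      obtain ⟨i, hi⟩ := Finset.card_eq_one.1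
        (card_eq_one_of_content hv (v (Fin.last k)).1 (by rw [h2]; simp))
      exact ⟨i, cellList_injective (by rw [h2, hi, hd])⟩)
  have h3 (v : NCell n (k + 1)) : (if listContent (cellList v) = τ then
      nbarEntry R n k v (critCell n k τ') else 0) =
      (if listContent (cellList v) = τ then
        barFace R (fun j => (v j).1) (fun j => (critCell n k τ' j).1) 0 else 0) +
      if listContent (cellList v) = τ then (-1 : R) ^ (k + 1) •
        barFace R (fun j => (v j).1) (fun j => (critCell n k τ' j).1) (Fin.last _) else 0 := by
    rw [nbarEntry_critCell]
    split_ifs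
    · rfl
    · rw [add_zero]
  rw [Finset.sum_congr rfl fun v _ => h3 v, Finset.sum_add_distrib, h1, h2,
    ← Finset.sum_add_distrib, mresD_apply]
  refine Finset.sum_congr rfl fun i _ => ?_
  have h4 : barFace R (fun j => (c i j).1) (fun j => (critCell n k τ' j).1) 0 =
      extX R n i ⊗ₜ 1 := by
    rw [barFace_zero, if_pos (tail_eq_iff.2 (by rw [hc, hc0])), hc0, extBasis_singleton]
  have h5 : barFace R (fun j => (d i j).1) (fun j => (critCell n k τ' j).1) (Fin.last _) =
      1 ⊗ₜ MulOpposite.op (extX R n i) := by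
    rw [barFace_last, if_pos (init_eq_iff.2 (by rw [hd, hdl])), hdl, extBasis_singleton]
  rw [Finsupp.single_apply, h4, h5]
  split_ifs
  · rw [one_mul, mresCoeff]
  · rw [zero_mul, add_zero]

theorem mresD_single_eq_pathSum {k : ℕ} (τ : Sym (Fin n) (k + 1)) (τ' : Sym (Fin n) k) :
    mresD R n k (Finsupp.single τ 1) τ' =
      pathSum (nbarEntry R n) (barMatching n) (critVertex R τ) (critVertex R τ') := by
  rcases subsingleton_or_nontrivial R with hR | hR
  · have : Subsingleton (Env R (ExtAlg R n)) := Module.subsingleton R _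
    exact Subsingleton.elim _ _
  · rw [mresD_single_eq_sum, pathSum_eq_sum]

end PathSum

theorem proposition1 (R : Type*) [CommRing R] (n : ℕ) :
    -- a free resolution of the bimodule `A`, with the explicit differential
    IsFreeResolution (X := MRes R n) (mresD R n) (mresAug R n) ∧
    -- it is minimal
    IsMinimalComplex (X := MRes R n) (mresD R n) ∧
    (Nontrivial R → ∀ (k : ℕ) (τ : Sym (Fin n) (k + 1)) (τ' : Sym (Fin n) k),
      ¬ IsUnit (mresD R n k (Finsupp.single τ 1) τ')) ∧
    -- the tensors with some inner factor `1` span a subcomplex of the bar resolution, so that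
    -- the normalized bar resolution is defined and has matrix entries `nbarEntry`
    (∀ (k : ℕ) (v : Fin (k + 1) → Finset (Fin n)) (w : NCell n k),
      (∃ j, v j = ∅) → barEntry R n k v (fun j => (w j).1) = 0) ∧
    -- the matching on its digraph is a Morse matching
    IsMorseMatching (nbarEntry R n) (barMatching n) ∧
    -- its unmatched vertices are exactly the `x_(τ)`
    (∀ k : ℕ, Function.Injective (critCell n k) ∧
      ∀ v : NCell n k, ¬ IsMatched (barMatching n) v ↔ v ∈ Set.range (critCell n k)) ∧
    -- the differential is the sum of the weights of all directed paths
    (∀ (k : ℕ) (τ : Sym (Fin n) (k + 1)) (τ' : Sym (Fin n) k),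
      Finite (Quiver.Path
        (⟨k + 1, critCell n (k + 1) τ⟩ : MorseVertex (nbarEntry R n) (barMatching n))
        ⟨k, critCell n k τ'⟩) ∧
      mresD R n k (Finsupp.single τ 1) τ' =
        pathSum (nbarEntry R n) (barMatching n)
          ⟨k + 1, critCell n (k + 1) τ⟩ ⟨k, critCell n k τ'⟩) ∧
    -- the resolution is homotopy equivalent, over `A`, to the bar resolution
    AreHomotopyEquivalentOver (X := MRes R n) (Y := Bar R (ExtAlg R n)) (mresD R n) (mresAug R n)
      (barD R (ExtAlg R n)) (barAug R (ExtAlg R n)) :=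
  ⟨isFreeResolution_mres R n, isMinimalComplex_mres, fun _ => not_isUnit_mresD,
    fun k v w ⟨j, hj⟩ => barEntry_eq_zero_of_empty k v _ (fun j => (w j).2) j hj,
    isMorseMatching_barMatching R n, fun k => ⟨critCell_injective k, not_isMatched_iff⟩,
    fun _ τ τ' => ⟨finite_path τ τ', mresD_single_eq_pathSum τ τ'⟩,
    (isFreeResolution_mres R n).areHomotopyEquivalentOver
      (isFreeResolution_bar R (ExtAlg R n) fun k => Module.Free.of_basis (barBasis R n k))⟩
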